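/- All graphs are simple (possibly uncountable), and all paths $v_0\ldots v_k$ may be trivial ($k=0$). A ray is a one-way infinite path, a double ray is a two-way infinite path, and the subrays of a (double) ray are its tails. Let $G$ be a graph. Two rays of $G$ are equivalent if no finite set of vertices separates them in $G$; the equivalence classes are the ends of $G$, and $\Omega(G)$ is the set of ends. For a finite $X\subseteq V(G)$ and an end $\omega$, let $C(X,\omega)$ be the unique component of $G-X$ that contains a tail of every ray in $\omega$. The end space of $G$ is the set $\Omega(G)$ with the topology that has as a basis the sets $\{\omega : C(X,\omega)=C\}$, where $X\subseteq V(G)$ is finite and $C$ is a component of $G-X$. A vertex $v$ dominates an end $\omega$ if for some ray $R\in\omega$ there are infinitely many paths from $v$ to vertices of $R-v$, each meeting $R-v$ only in its last vertex, any two of which meet only in $v$. A generalised path in $G$ is a pair $(P,\{\omega_1,\omega_2\})$ where $\omega_1\ne\omega_2$ are ends of $G$ and $P\subseteq G$ is either a double ray with one tail in $\omega_1$ and another tail in $\omega_2$, or a finite path $v_0\ldots v_k$ such that $v_0$ dominates $\omega_1$ and $v_k$ dominates $\omega_2$, or a ray in $\omega_1$ whose first vertex dominates $\omega_2$. Two generalised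 paths $(P,\Psi)$ and $(P',\Psi')$ are vertex-disjoint if $P$ and $P'$ have no common vertex; they are disjoint if moreover $\Psi\cap\Psi'=\emptyset$. A sun in $G$ with centre $\omega\in\Omega(G)$ is a collection $\{(P^i,\{\omega,\omega^i\}) : i\in I\}$ of pairwise vertex-disjoint generalised paths with pairwise distinct ends $\omega^i$ such that either every $P^i$ is a double ray, or every $P^i$ is a ray in $\omega^i$ whose first vertex dominates $\omega$. A finite vertex set $X$ separates a set of ends simultaneously if distinct ends in it live in distinct components of $G-X$, i.e. $C(X,\omega)\neq C(X,\omega')$ for all distinct $\omega,\omega'$ in it. **Theorem.** For every connected graph $G$ the following assertions are equivalent: (i) The end space of $G$ is not second countable. (ii) The graph $G$ contains an uncountable sun, or uncountably many pairwise disjoint generalised paths, or a finite vertex set that separates uncountably many ends of $G$ simultaneously. -/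

import Mathlib

namespace GraphEnds

open Filter

variable {V : Type*}

/-- A ray: a one-way infinite path `x₀ x₁ x₂ …`, given by its vertices in order. -/
structure Ray (G : SimpleGraph V) where
  toFun : ℕ → V
  injective : Function.Injective toFun
  adj : ∀ n, G.Adj (toFun n) (toFun (n + 1))

/-- A double ray: a two-way infinite path `… x₋₁ x₀ x₁ …`, given by its vertices in order. -/
structure DoubleRay (G : SimpleGraph V) where
  toFun : ℤ → V
  injective : Function.Injective toFun
  adj : ∀ n, G.Adj (toFun n) (toFun (n + 1))

variable {G : SimpleGraph V}

/-- The subgraph of `G` formed by the vertices and edges of a ray. -/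
def Ray.toSubgraph (R : Ray G) : G.Subgraph where
  verts := Set.range R.toFun
  Adj u v := ∃ n, (R.toFun n = u ∧ R.toFun (n + 1) = v) ∨ (R.toFun n = v ∧ R.toFun (n + 1) = u)
  adj_sub := by
    rintro u v ⟨n, ⟨rfl, rfl⟩ | ⟨rfl, rfl⟩⟩
    · exact R.adj n
    · exact (R.adj n).symm
  edge_vert := by
    rintro u v ⟨n, ⟨rfl, rfl⟩ | ⟨rfl, rfl⟩⟩
    · exact ⟨n, rfl⟩
    · exact ⟨n + 1, rfl⟩
  symm := ⟨fun _ _ ⟨n, h⟩ => ⟨n, h.symm⟩⟩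

/-- The subgraph of `G` formed by the vertices and edges of a double ray. -/
def DoubleRay.toSubgraph (D : DoubleRay G) : G.Subgraph where
  verts := Set.range D.toFun
  Adj u v := ∃ n, (D.toFun n = u ∧ D.toFun (n + 1) = v) ∨ (D.toFun n = v ∧ D.toFun (n + 1) = u)
  adj_sub := by
    rintro u v ⟨n, ⟨rfl, rfl⟩ | ⟨rfl, rfl⟩⟩
    · exact D.adj n
    · exact (D.adj n).symm
  edge_vert := by
    rintro u v ⟨n, ⟨rfl, rfl⟩ | ⟨rfl, rfl⟩⟩
    · exact ⟨n, rfl⟩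
    · exact ⟨n + 1, rfl⟩
  symm := ⟨fun _ _ ⟨n, h⟩ => ⟨n, h.symm⟩⟩

/-- The half `x₀ x₁ x₂ …` of a double ray. -/
def DoubleRay.posRay (D : DoubleRay G) : Ray G where
  toFun n := D.toFun n
  injective m n h := by
    have := D.injective h
    exact_mod_cast this
  adj n := by
    have := D.adj n
    push_cast
    exact this

/-- The half `x₀ x₋₁ x₋₂ …` of a double ray. -/
def DoubleRay.negRay (D : DoubleRay G) : Ray G where
  toFun n := D.toFun (-(n : ℤ))
  injective m n h := by
    have := D.injective h
    have h2 : (m : ℤ) = n := by linarith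
    exact_mod_cast h2
  adj n := by
    have h := D.adj (-((n + 1 : ℕ) : ℤ))
    have e : -((n + 1 : ℕ) : ℤ) + 1 = -(n : ℤ) := by push_cast; ring
    rw [e] at h
    exact h.symm

/-- A set `X` of vertices separates two rays if every walk in `G` from a vertex of the one to a
vertex of the other meets `X`. -/
def Ray.SeparatedBy (R S : Ray G) (X : Set V) : Prop :=
  ∀ (m n : ℕ) (p : G.Walk (R.toFun m) (S.toFun n)), ∃ v ∈ p.support, v ∈ X

/-- Two rays are equivalent if no finite set of vertices separates them. -/
def Ray.Equivalent (R S : Ray G) : Prop :=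
  ∀ X : Finset V, ¬ R.SeparatedBy S (X : Set V)

theorem Ray.eventually_notMem (R : Ray G) (X : Finset V) :
    ∃ N, ∀ n ≥ N, R.toFun n ∉ X := by
  have h : (R.toFun ⁻¹' (X : Set V)).Finite := X.finite_toSet.preimage R.injective.injOn
  obtain ⟨N, hN⟩ := h.bddAbove
  exact ⟨N + 1, fun n hn hX => by
    have : n ≤ N := hN (by simpa using hX)
    omega⟩

/-- Every ray has a tail in some component of `G - X`, for every finite `X`. -/
theorem Ray.exists_component (R : Ray G) (X : Finset V) :
    ∃ C : G.ComponentCompl (X : Set V), ∃ N, ∀ n ≥ N, R.toFun n ∈ C := by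
  obtain ⟨N, hN⟩ := R.eventually_notMem X
  have hN' : R.toFun N ∉ (X : Set V) := by simpa using hN N le_rfl
  refine ⟨G.componentComplMk hN', N, fun n hn => ?_⟩
  induction n, hn using Nat.le_induction with
  | base => exact G.componentComplMk_mem hN'
  | succ n hn ih =>
    exact SimpleGraph.ComponentCompl.mem_of_adj _ _ ih
      (by simpa using hN (n + 1) (by omega)) (R.adj n)

/-- The component of `G - X` that contains a tail of the ray `R`. -/
noncomputable def Ray.comp (R : Ray G) (X : Finset V) : G.ComponentCompl (X : Set V) :=
  (R.exists_component X).choose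

theorem Ray.comp_spec (R : Ray G) (X : Finset V) : ∃ N, ∀ n ≥ N, R.toFun n ∈ R.comp X :=
  (R.exists_component X).choose_spec

theorem mem_component_of_walk {X : Set V} (C : G.ComponentCompl X) {u v : V} (p : G.Walk u v)
    (hp : ∀ x ∈ p.support, x ∉ X) (hu : u ∈ C) : v ∈ C := by
  induction p with
  | nil => exact hu
  | cons h q ih =>
    refine ih (fun x hx => hp x (by simp [hx])) ?_
    exact SimpleGraph.ComponentCompl.mem_of_adj _ _ hu (hp _ (by simp)) h

theorem exists_walk_of_mem_component {X : Set V} (C : G.ComponentCompl X) {u v : V}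
    (hu : u ∈ C) (hv : v ∈ C) : ∃ p : G.Walk u v, ∀ x ∈ p.support, x ∉ X := by
  obtain ⟨hu', rfl⟩ := hu
  obtain ⟨hv', hv⟩ := hv
  obtain ⟨p⟩ := (SimpleGraph.ConnectedComponent.exact hv).symm
  let q : G.Walk u v := p.map (SimpleGraph.Embedding.induce Xᶜ).toHom
  have hq : q.support = p.support.map (SimpleGraph.Embedding.induce Xᶜ).toHom :=
    SimpleGraph.Walk.support_map _ _
  refine ⟨q, fun x hx => ?_⟩
  rw [hq, List.mem_map] at hx
  obtain ⟨y, -, rfl⟩ := hx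
  exact y.2

theorem Ray.equivalent_iff (R S : Ray G) :
    R.Equivalent S ↔ ∀ X : Finset V, R.comp X = S.comp X := by
  classical
  constructor
  · intro h X
    obtain ⟨M, hM⟩ := R.comp_spec X
    obtain ⟨N, hN⟩ := S.comp_spec X
    have h1 := h (X ∪ (Finset.range M).image R.toFun ∪ (Finset.range N).image S.toFun)
    simp only [Ray.SeparatedBy, not_forall, not_exists, not_and] at h1
    obtain ⟨m, n, p, hp⟩ := h1
    have hm : M ≤ m := by
      by_contra hlt
      refine hp _ p.start_mem_support ?_
      have : ∃ a < M, R.toFun a = R.toFun m := ⟨m, by omega, rfl⟩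
      simp [this]
    have hn : N ≤ n := by
      by_contra hlt
      refine hp _ p.end_mem_support ?_
      have : ∃ a < N, S.toFun a = S.toFun n := ⟨n, by omega, rfl⟩
      simp [this]
    have h2 : S.toFun n ∈ R.comp X :=
      mem_component_of_walk _ p (fun x hx hX => hp x hx (by
        have : x ∈ X := by simpa using hX
        simp [this])) (hM m hm)
    by_contra hne
    exact Set.disjoint_left.mp (SimpleGraph.ComponentCompl.pairwise_disjoint hne) h2 (hN n hn)
  · intro h X hs
    obtain ⟨M, hM⟩ := R.comp_spec X
    obtain ⟨N, hN⟩ := S.comp_spec X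
    obtain ⟨p, hp⟩ := exists_walk_of_mem_component (R.comp X) (hM M le_rfl)
      (by rw [h X]; exact hN N le_rfl)
    obtain ⟨v, hv, hvX⟩ := hs M N p
    exact hp v hv hvX

/-- Equivalence of rays as a setoid. -/
def raySetoid (G : SimpleGraph V) : Setoid (Ray G) where
  r := Ray.Equivalent
  iseqv :=
    { refl := fun R => (R.equivalent_iff R).2 fun _ => rfl
      symm := fun {R S} h => (S.equivalent_iff R).2 fun X => ((R.equivalent_iff S).1 h X).symm
      trans := fun {R S T} h k => (R.equivalent_iff T).2 fun X =>
        ((R.equivalent_iff S).1 h X).trans ((S.equivalent_iff T).1 k X) }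

/-- The set `Ω(G)` of ends of `G`: equivalence classes of rays. -/
def EndSpace (G : SimpleGraph V) : Type _ := Quotient (raySetoid G)

/-- The end that contains the ray `R`. -/
def Ray.toEnd (R : Ray G) : EndSpace G := Quotient.mk (raySetoid G) R

/-- `C(X, ω)`: the component of `G - X` that contains a tail of every ray in `ω`. -/
noncomputable def EndSpace.comp (X : Finset V) (ω : EndSpace G) : G.ComponentCompl (X : Set V) :=
  Quotient.lift (fun R : Ray G => R.comp X) (fun R S h => (R.equivalent_iff S).1 h X) ω

/-- `Ω(X, C)`: the set of ends of `G` that live in the component `C` of `G - X`. -/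
def endsIn (X : Finset V) (C : G.ComponentCompl (X : Set V)) : Set (EndSpace G) :=
  {ω | ω.comp X = C}

/-- The topology on `Ω(G)` whose basis are the sets `Ω(X, C)` with `X` a finite set of vertices
and `C` a component of `G - X`. -/
instance : TopologicalSpace (EndSpace G) :=
  TopologicalSpace.generateFrom
    {U | ∃ (X : Finset V) (C : G.ComponentCompl (X : Set V)), U = endsIn X C}

/-- The vertex `v` dominates the ray `R`: there is an infinite `v`–`(R - v)` fan in `G`, that is,
there are infinitely many paths from `v` to `R - v`, each meeting `R - v` only in its last vertex,
any two of which meet only in `v`. -/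
def DominatesRay (v : V) (R : Ray G) : Prop :=
  ∃ (w : ℕ → V) (p : ∀ n, G.Walk v (w n)),
    (∀ n, (p n).IsPath) ∧
    (∀ n, {x | x ∈ (p n).support} ∩ (Set.range R.toFun \ {v}) = {w n}) ∧
    (∀ m n, m ≠ n → ∀ x, x ∈ (p m).support → x ∈ (p n).support → x = v)

/-- The vertex `v` dominates the end `ω`: it dominates some ray of `ω`. -/
def Dominates (v : V) (ω : EndSpace G) : Prop :=
  ∃ R : Ray G, R.toEnd = ω ∧ DominatesRay v R

/-- `P` is a double ray with one tail in `ω₁` and another tail in `ω₂`. -/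
def IsDoubleRayBetween (P : G.Subgraph) (ω₁ ω₂ : EndSpace G) : Prop :=
  ∃ D : DoubleRay G, P = D.toSubgraph ∧ D.negRay.toEnd = ω₁ ∧ D.posRay.toEnd = ω₂

/-- `P` is a finite path `v₀ … vₖ` such that `v₀` dominates `ω₁` and `vₖ` dominates `ω₂`. -/
def IsFinitePathBetween (P : G.Subgraph) (ω₁ ω₂ : EndSpace G) : Prop :=
  ∃ (v w : V) (p : G.Walk v w), p.IsPath ∧ P = p.toSubgraph ∧ Dominates v ω₁ ∧ Dominates w ω₂

/-- `P` is a ray in `ω₁` whose first vertex dominates `ω₂`. -/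
def IsRayBetween (P : G.Subgraph) (ω₁ ω₂ : EndSpace G) : Prop :=
  ∃ R : Ray G, P = R.toSubgraph ∧ R.toEnd = ω₁ ∧ Dominates (R.toFun 0) ω₂

/-- A generalised path `(P, {ω₁, ω₂})` in `G`. -/
structure GeneralisedPath (G : SimpleGraph V) where
  path : G.Subgraph
  ends : Set (EndSpace G)
  isGeneralisedPath : ∃ ω₁ ω₂ : EndSpace G, ω₁ ≠ ω₂ ∧ ends = {ω₁, ω₂} ∧
    (IsDoubleRayBetween path ω₁ ω₂ ∨ IsFinitePathBetween path ω₁ ω₂ ∨ IsRayBetween path ω₁ ω₂)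

/-- Two generalised paths are vertex-disjoint if their underlying paths have no common vertex. -/
def GeneralisedPath.VertexDisjoint (P Q : GeneralisedPath G) : Prop :=
  Disjoint P.path.verts Q.path.verts

/-- Two generalised paths are disjoint if they are vertex-disjoint and have no common endpoint. -/
def GeneralisedPath.IsDisjoint (P Q : GeneralisedPath G) : Prop :=
  P.VertexDisjoint Q ∧ Disjoint P.ends Q.ends

/-- The collection `S` is a generalised star with centre `ω`, where `leaf P` is the endpoint of
`P ∈ S` other than `ω`: the members of `S` are pairwise vertex-disjoint generalised paths
`(P, {ω, leaf P})` with distinct leaves. -/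
structure IsGeneralisedStar (S : Set (GeneralisedPath G)) (ω : EndSpace G)
    (leaf : GeneralisedPath G → EndSpace G) : Prop where
  ends_eq : ∀ P ∈ S, P.ends = {ω, leaf P}
  vertexDisjoint : S.Pairwise GeneralisedPath.VertexDisjoint
  leaf_injOn : Set.InjOn leaf S

/-- The collection `S` is a sun with centre `ω`, that is, a proper generalised star: either all its
paths are double rays, or all its paths are rays in their leaves whose first vertices
dominate `ω`. -/
def IsSun (S : Set (GeneralisedPath G)) (ω : EndSpace G) : Prop :=
  ∃ leaf : GeneralisedPath G → EndSpace G, IsGeneralisedStar S ω leaf ∧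
    ((∀ P ∈ S, ∃ D : DoubleRay G, P.path = D.toSubgraph) ∨
      (∀ P ∈ S, IsRayBetween P.path (leaf P) ω))

/-- The finite set `X` of vertices separates the ends in `Ψ` simultaneously: distinct ends in `Ψ`
live in distinct components of `G - X`. -/
def SeparatesSimultaneously (X : Finset V) (Ψ : Set (EndSpace G)) : Prop :=
  Ψ.Pairwise fun ω₁ ω₂ => ω₁.comp X ≠ ω₂.comp X

end GraphEnds

namespace GraphEnds

variable {V : Type*} {G : SimpleGraph V}

/-! Suppose that every sun, every family of disjoint generalised paths and every simultaneously
separated set of ends is countable. The aim is a countable vertex set `U` that meets every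
generalised path (`exists_countable_meeting`). A maximal disjoint family supplies countably many
vertices and ends such that a generalised path avoiding the vertices has one of these ends. So it
remains to meet all generalised paths at a fixed end `ω` (`exists_countable_meeting_end`): maximal
generalised stars of the two sun types handle these types, and the paths left over are controlled by
the components of `G - U`.

This control comes from closing `U` under walks avoiding finite subsets of `U` (`WalkClosed`). The
boundary of a component `D` of `G - U` then converges to at most one end (`BoundaryLimit.unique`),
and by a star–comb argument `D` contains a ray of that end or a vertex dominating it
(`BoundaryLimit.reaches`). Hence two different ends reached from `D`, at least one of them by a ray,
yield a generalised path inside `D`.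

Exhaust such a `U` by finite sets `X n`. As no generalised path avoids `U`, the sets `endsIn (X n)
(ω.comp (X n))` form a neighbourhood base at every end `ω` (`exists_endsIn_subset`). For each `n`
only countably many components of `G - X n` contain ends, so these sets form a countable subbasis.

Conversely, a countable basis yields countably many finite separators for all pairs of ends. Every
generalised path meets one of them, so vertex-disjoint families are countable; simultaneously
separated ends have disjoint open neighbourhoods. -/

/-- A set of vertices any two of which are joined by a walk inside the set. -/
def ConnSet (G : SimpleGraph V) (A : Set V) : Prop :=
  ∀ a ∈ A, ∀ b ∈ A, ∃ p : G.Walk a b, ∀ x ∈ p.support, x ∈ A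

/-- The vertices outside `D` with a neighbour in `D`. -/
def boundary (G : SimpleGraph V) (D : Set V) : Set V :=
  {a | a ∉ D ∧ ∃ d ∈ D, G.Adj d a}

/-! ### Splitting walks at a vertex set. -/

/-- Last exit: cut the walk after its final vertex in `S`. -/
theorem exists_crossing {S : Set V} {u v : V} (p : G.Walk u v) (hu : ∃ z ∈ p.support, z ∈ S)
    (hv : v ∉ S) : ∃ x ∈ S, ∃ y, G.Adj x y ∧ ∃ q : G.Walk y v,
      (∀ z ∈ q.support, z ∈ p.support) ∧ ∀ z ∈ q.support, z ∉ S := by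
  induction p with
  | nil =>
    obtain ⟨z, hz, hzS⟩ := hu
    rw [SimpleGraph.Walk.support_nil, List.mem_singleton] at hz
    exact absurd (hz ▸ hzS) hv
  | @cons u w v h q ih =>
    by_cases hq : ∃ z ∈ q.support, z ∈ S
    · obtain ⟨x, hx, y, hxy, r, hr, hr'⟩ := ih hq hv
      exact ⟨x, hx, y, hxy, r, fun z hz => by simp [hr z hz], hr'⟩
    · push Not at hq
      obtain ⟨z, hz, hzS⟩ := hu
      rw [SimpleGraph.Walk.support_cons, List.mem_cons] at hz
      rcases hz with rfl | hz
      · exact ⟨z, hzS, w, h, q, fun z hz => by simp [hz], hq⟩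
      · exact absurd hzS (hq z hz)

theorem exists_walk_first_hit {S : Set V} {u v : V} (p : G.Walk u v) (hv : v ∈ S) :
    ∃ w ∈ S, ∃ q : G.Walk u w, (∀ z ∈ q.support, z ∈ p.support) ∧
      ∀ z ∈ q.support, z ∈ S → z = w := by
  induction p with
  | @nil u => exact ⟨u, hv, .nil, by simp, by simp⟩
  | @cons u a v h q ih =>
    by_cases hu : u ∈ S
    · exact ⟨u, hu, .nil, by simp, by simp⟩
    · obtain ⟨w, hw, r, hr, hr'⟩ := ih hv
      refine ⟨w, hw, .cons h r, fun z hz => ?_, fun z hz hzS => ?_⟩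
      · simp only [SimpleGraph.Walk.support_cons, List.mem_cons] at hz ⊢
        exact hz.imp id (hr z)
      · simp only [SimpleGraph.Walk.support_cons, List.mem_cons] at hz
        rcases hz with rfl | hz
        · exact absurd hzS hu
        · exact hr' z hz hzS

/-! ### Connected sets and components -/

theorem ComponentCompl.notMem {X : Set V} (C : G.ComponentCompl X) {v : V} (h : v ∈ C) : v ∉ X :=
  h.1

theorem ComponentCompl.eq_of_mem {X : Set V} {C C' : G.ComponentCompl X} {v : V} (h : v ∈ C)
    (h' : v ∈ C') : C = C' := by
  by_contra hne
  exact Set.disjoint_left.mp (SimpleGraph.ComponentCompl.pairwise_disjoint hne) h h'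

theorem ComponentCompl.connSet {X : Set V} (C : G.ComponentCompl X) : ConnSet G (C : Set V) := by
  classical
  intro a ha b hb
  obtain ⟨p, hp⟩ := exists_walk_of_mem_component C ha hb
  exact ⟨p, fun x hx => mem_component_of_walk C (p.takeUntil x hx)
    (fun y hy => hp y (p.support_takeUntil_subset_support hx hy)) ha⟩

theorem ComponentCompl.boundary_subset {X : Set V} (C : G.ComponentCompl X) :
    boundary G (C : Set V) ⊆ X := by
  rintro a ⟨ha, d, hd, had⟩
  by_contra hX
  exact ha (SimpleGraph.ComponentCompl.mem_of_adj _ _ hd hX had)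

theorem ConnSet.subset_component {A X : Set V} (hA : ConnSet G A) (hAX : ∀ a ∈ A, a ∉ X)
    (C : G.ComponentCompl X) {v : V} (hv : v ∈ A) (hvC : v ∈ C) : ∀ a ∈ A, a ∈ C := by
  intro a ha
  obtain ⟨p, hp⟩ := hA v hv a ha
  exact mem_component_of_walk C p (fun x hx => hAX x (hp x hx)) hvC

theorem ConnSet.exists_component {A X : Set V} (hA : ConnSet G A) (hAX : ∀ a ∈ A, a ∉ X)
    {v : V} (hv : v ∈ A) : ∃ C : G.ComponentCompl X, ∀ a ∈ A, a ∈ C :=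
  ⟨G.componentComplMk (hAX v hv), hA.subset_component hAX _ hv (G.componentComplMk_mem _)⟩

theorem ConnSet.inter_boundary {A D : Set V} (hA : ConnSet G A) {u v : V} (hu : u ∈ A)
    (huD : u ∈ D) (hv : v ∈ A) (hvD : v ∉ D) : ∃ a ∈ A, a ∈ boundary G D := by
  obtain ⟨p, hp⟩ := hA u hu v hv
  obtain ⟨x, hx, y, hxy, q, hq, hq'⟩ := exists_crossing p ⟨u, p.start_mem_support, huD⟩ hvD
  exact ⟨y, hp _ (hq _ q.start_mem_support), hq' _ q.start_mem_support, x, hx, hxy⟩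

/-! ### Ends and their components -/

theorem EndSpace.exists_ray (ω : EndSpace G) : ∃ R : Ray G, R.toEnd = ω :=
  Quotient.exists_rep ω

theorem Ray.eventually_mem (R : Ray G) (X : Finset V) :
    ∃ N, ∀ n ≥ N, R.toFun n ∈ R.toEnd.comp X :=
  R.comp_spec X

theorem EndSpace.ext {ω η : EndSpace G} (h : ∀ X : Finset V, ω.comp X = η.comp X) : ω = η := by
  obtain ⟨R, rfl⟩ := ω.exists_ray
  obtain ⟨S, rfl⟩ := η.exists_ray
  exact Quotient.sound ((R.equivalent_iff S).2 h)

theorem EndSpace.exists_comp_ne {ω η : EndSpace G} (h : ω ≠ η) :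
    ∃ X : Finset V, ω.comp X ≠ η.comp X := by
  by_contra! hX
  exact h (EndSpace.ext hX)

theorem EndSpace.comp_mono (ω : EndSpace G) {X Y : Finset V} (h : X ⊆ Y) :
    ∀ v ∈ ω.comp Y, v ∈ ω.comp X := by
  obtain ⟨R, rfl⟩ := ω.exists_ray
  obtain ⟨M, hM⟩ := R.eventually_mem X
  obtain ⟨N, hN⟩ := R.eventually_mem Y
  refine (ComponentCompl.connSet _).subset_component
    (fun a ha haX => ComponentCompl.notMem _ ha (h haX)) _ (hN (max M N) (le_max_right _ _))
    (hM (max M N) (le_max_left _ _))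

/-- The tail of a ray from index `k` on. -/
def Ray.drop (R : Ray G) (k : ℕ) : Ray G where
  toFun n := R.toFun (k + n)
  injective m n h := by simpa using R.injective h
  adj n := R.adj (k + n)

theorem Ray.toEnd_eq_of_frequently {R : Ray G} {ω : EndSpace G}
    (h : ∀ X : Finset V, ∀ N, ∃ n ≥ N, R.toFun n ∈ ω.comp X) : R.toEnd = ω := by
  refine EndSpace.ext fun X => ?_
  obtain ⟨N, hN⟩ := R.eventually_mem X
  obtain ⟨n, hn, hnω⟩ := h X N
  exact ComponentCompl.eq_of_mem (hN n hn) hnω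

theorem Ray.toEnd_drop (R : Ray G) (k : ℕ) : (R.drop k).toEnd = R.toEnd := by
  refine Ray.toEnd_eq_of_frequently fun X N => ?_
  obtain ⟨M, hM⟩ := R.eventually_mem X
  exact ⟨max M N, le_max_right _ _, hM _ (by omega)⟩

theorem Ray.connSet (R : Ray G) : ConnSet G (Set.range R.toFun) := by
  have key : ∀ m n, m ≤ n → ∃ p : G.Walk (R.toFun m) (R.toFun n),
      ∀ x ∈ p.support, x ∈ Set.range R.toFun := by
    intro m n hmn
    induction n, hmn using Nat.le_induction with
    | base => exact ⟨.nil, by simp⟩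
    | succ n _ ih =>
      obtain ⟨p, hp⟩ := ih
      refine ⟨p.concat (R.adj n), fun x hx => ?_⟩
      rw [SimpleGraph.Walk.support_concat] at hx
      simp only [List.mem_append, List.mem_singleton] at hx
      rcases hx with hx | rfl
      · exact hp x hx
      · exact ⟨_, rfl⟩
  rintro _ ⟨m, rfl⟩ _ ⟨n, rfl⟩
  rcases le_total m n with h | h
  · exact key m n h
  · obtain ⟨p, hp⟩ := key n m h
    exact ⟨p.reverse, fun x hx => hp x (by simpa using hx)⟩

theorem ConnSet.union {A B : Set V} (hA : ConnSet G A) (hB : ConnSet G B) {v : V} (hvA : v ∈ A)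
    (hvB : v ∈ B) : ConnSet G (A ∪ B) := by
  have key : ∀ a ∈ A ∪ B, ∃ p : G.Walk a v, ∀ x ∈ p.support, x ∈ A ∪ B := by
    rintro a (ha | ha)
    · obtain ⟨p, hp⟩ := hA a ha v hvA
      exact ⟨p, fun x hx => Or.inl (hp x hx)⟩
    · obtain ⟨p, hp⟩ := hB a ha v hvB
      exact ⟨p, fun x hx => Or.inr (hp x hx)⟩
  intro a ha b hb
  obtain ⟨p, hp⟩ := key a ha
  obtain ⟨q, hq⟩ := key b hb
  refine ⟨p.append q.reverse, fun x hx => ?_⟩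
  rw [SimpleGraph.Walk.mem_support_append_iff] at hx
  rcases hx with hx | hx
  · exact hp x hx
  · exact hq x (by simpa using hx)

theorem connSet_support {u v : V} (p : G.Walk u v) : ConnSet G {x | x ∈ p.support} := by
  classical
  intro a ha b hb
  refine ⟨(p.takeUntil a ha).reverse.append (p.takeUntil b hb), fun x hx => ?_⟩
  rw [SimpleGraph.Walk.mem_support_append_iff] at hx
  rcases hx with hx | hx
  · exact p.support_takeUntil_subset_support ha (by simpa using hx)
  · exact p.support_takeUntil_subset_support hb hx

/-! ### Constructing rays and double rays inside connected sets. -/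

/-- A decreasing sequence of nonempty connected sets with empty intersection contains a ray with a
tail in each of them. -/
theorem exists_ray_of_antitone (A : ℕ → Set V) (hA : Antitone A) (hconn : ∀ n, ConnSet G (A n))
    (hne : ∀ n, (A n).Nonempty) (hempty : ∀ v, ∃ n, v ∉ A n) {x : V} (hx : x ∈ A 0) :
    ∃ R : Ray G, R.toFun 0 = x ∧ (∀ n, R.toFun n ∈ A 0) ∧ ∀ k, ∃ N, ∀ n ≥ N, R.toFun n ∈ A k := by
  classical
  -- The rank `r y` is the last index `n` with `y ∈ A n`; below, `d y` is the distance from `y` to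
  -- `A (r y + 1)` inside `A (r y)`.
  have hr : ∀ y ∈ A 0, ∃ r, y ∈ A r ∧ y ∉ A (r + 1) := by
    intro y hy
    by_contra! h
    obtain ⟨n, hn⟩ := hempty y
    exact hn (Nat.rec hy (fun k ih => h k ih) n)
  choose! r hrmem hrnot using hr
  have hlt : ∀ y ∈ A 0, ∀ k, y ∈ A k → k ≤ r y := fun y hy k hk => by
    by_contra! hkr
    exact hrnot y hy (hA hkr hk)
  have hd : ∀ y ∈ A 0, ∃ d : ℕ, ∃ z ∈ A (r y + 1), ∃ p : G.Walk y z,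
      (∀ w ∈ p.support, w ∈ A (r y)) ∧ p.length = d := by
    intro y hy
    obtain ⟨z, hz⟩ := hne (r y + 1)
    obtain ⟨p, hp⟩ := hconn (r y) y (hrmem y hy) z (hA (Nat.le_succ _) hz)
    exact ⟨p.length, z, hz, p, hp, rfl⟩
  let d : V → ℕ := fun y => if hy : y ∈ A 0 then Nat.find (hd y hy) else 0
  have hdle : ∀ y (hy : y ∈ A 0) z, z ∈ A (r y + 1) → ∀ p : G.Walk y z,
      (∀ w ∈ p.support, w ∈ A (r y)) → d y ≤ p.length := fun y hy z hz p hp => by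
    simp only [d, dif_pos hy]
    exact Nat.find_min' _ ⟨z, hz, p, hp, rfl⟩
  -- Move to the next vertex of a shortest walk to the next set: either the rank rises or the
  -- distance drops.
  have hstep : ∀ y ∈ A 0, ∃ y', G.Adj y y' ∧ y' ∈ A (r y) ∧ (r y' = r y → d y' < d y) := by
    intro y hy
    obtain ⟨z, hz, p, hp, hpd⟩ := Nat.find_spec (hd y hy)
    have hdy : d y = p.length := by simp only [d, dif_pos hy]; exact hpd.symm
    cases p with
    | nil => exact absurd hz (hrnot y hy)
    | @cons _ y' _ h q =>
      have hy' : y' ∈ A (r y) := hp _ (by simp)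
      refine ⟨y', h, hy', fun he => ?_⟩
      have h0 : y' ∈ A 0 := hA (Nat.zero_le _) hy'
      have := hdle y' h0 z (he.symm ▸ hz) q (fun w hw => he.symm ▸ hp w (by simp [hw]))
      rw [hdy, SimpleGraph.Walk.length_cons]
      omega
  choose! nxt hadj hmem hdec using hstep
  let f : ℕ → V := fun n => nxt^[n] x
  have hf0 : ∀ n, f n ∈ A 0 := by
    intro n
    induction n with
    | zero => exact hx
    | succ n ih =>
      simp only [f, Function.iterate_succ_apply'] at ih ⊢
      exact hA (Nat.zero_le _) (hmem _ ih)
  have hfs : ∀ n, f (n + 1) = nxt (f n) := fun n => Function.iterate_succ_apply' nxt n x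
  have hrs : ∀ n, r (f n) ≤ r (f (n + 1)) := fun n =>
    hlt _ (hf0 _) _ (by rw [hfs]; exact hmem _ (hf0 n))
  have hmono : Monotone fun n => r (f n) := monotone_nat_of_le_succ hrs
  -- While the rank is constant, `d` loses at least one per step. So no vertex is repeated and the
  -- rank is unbounded.
  have hds : ∀ m n, r (f (m + n)) = r (f m) → d (f (m + n)) + n ≤ d (f m) := by
    intro m n
    induction n with
    | zero => intro _; simp
    | succ n ih =>
      intro h
      have h1 : r (f m) ≤ r (f (m + n)) := hmono (by omega)
      have h2 : r (f (m + n)) ≤ r (f (m + (n + 1))) := hrs (m + n)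
      have h3 := ih (by omega)
      have h4 := hdec (f (m + n)) (hf0 _) (by
        rw [← hfs]
        exact le_antisymm (by rw [Nat.add_assoc]; omega) h2)
      rw [← hfs, Nat.add_assoc] at h4
      omega
  have hinj : ∀ m n, 0 < n → f (m + n) ≠ f m := fun m n hn h => by
    have := hds m n (by rw [h])
    rw [h] at this
    omega
  refine ⟨⟨f, fun m n h => ?_, fun n => by rw [hfs]; exact hadj _ (hf0 n)⟩, rfl, hf0, fun k => ?_⟩
  · rcases lt_trichotomy m n with hmn | hmn | hmn
    · obtain ⟨j, rfl⟩ := Nat.exists_eq_add_of_lt hmn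
      exact absurd h.symm (hinj m (j + 1) (by omega))
    · exact hmn
    · obtain ⟨j, rfl⟩ := Nat.exists_eq_add_of_lt hmn
      exact absurd h (hinj n (j + 1) (by omega))
  · obtain ⟨N, hN⟩ : ∃ N, k ≤ r (f N) := by
      induction k with
      | zero => exact ⟨0, Nat.zero_le _⟩
      | succ k ih =>
        obtain ⟨N, hN⟩ := ih
        by_contra! hk
        have := hds N (d (f N) + 1) (by
          have h1 := hk (N + (d (f N) + 1))
          have h2 := hk N
          have h3 : r (f N) ≤ r (f (N + (d (f N) + 1))) := hmono (by omega)
          omega)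
        omega
    exact ⟨N, fun n hn => hA (hN.trans (hmono hn)) (hrmem _ (hf0 n))⟩

/-- Apply `exists_ray_of_antitone` to `A` followed by the vertex sets of the tails of `R`: the new
ray finally stays in every tail of `R`, so it has the same end. -/
theorem ConnSet.exists_ray_from {A : Set V} (hA : ConnSet G A) {R : Ray G}
    (hR : ∀ n, R.toFun n ∈ A) {x : V} (hx : x ∈ A) :
    ∃ S : Ray G, S.toFun 0 = x ∧ (∀ n, S.toFun n ∈ A) ∧ S.toEnd = R.toEnd := by
  let B : ℕ → Set V := fun n => Nat.casesOn n A fun k => Set.range (R.drop k).toFun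
  have hB0 : B 0 = A := rfl
  have hBs : ∀ k, B (k + 1) = Set.range (R.drop k).toFun := fun _ => rfl
  have hmono : Antitone B := by
    refine antitone_nat_of_succ_le fun n => ?_
    cases n with
    | zero =>
      rintro _ ⟨m, rfl⟩
      exact hR _
    | succ k =>
      rintro _ ⟨m, rfl⟩
      refine ⟨m + 1, ?_⟩
      simp only [Ray.drop]
      congr 1
      omega
  obtain ⟨S, hS0, hSA, hS⟩ := exists_ray_of_antitone B hmono
    (fun n => by cases n with
      | zero => exact hA
      | succ k => exact (R.drop k).connSet)
    (fun n => by cases n with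
      | zero => exact ⟨x, hx⟩
      | succ k => exact ⟨_, 0, rfl⟩)
    (fun v => by
      by_cases hv : ∃ k, R.toFun k = v
      · obtain ⟨k, rfl⟩ := hv
        refine ⟨k + 2, ?_⟩
        rintro ⟨m, hm⟩
        have : k + 1 + m = k := R.injective hm
        omega
      · refine ⟨1, ?_⟩
        rintro ⟨m, rfl⟩
        exact hv ⟨_, rfl⟩) (x := x) hx
  refine ⟨S, hS0, hSA, Ray.toEnd_eq_of_frequently fun X N => ?_⟩
  obtain ⟨M, hM⟩ := R.eventually_mem X
  obtain ⟨K, hK⟩ := hS (M + 1)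
  refine ⟨max K N, le_max_right _ _, ?_⟩
  obtain ⟨m, hm⟩ := hK (max K N) (le_max_left _ _)
  rw [← hm]
  exact hM _ (by omega)

theorem Ray.ext {R S : Ray G} (h : ∀ n, R.toFun n = S.toFun n) : R = S := by
  cases R
  cases S
  congr 1
  exact funext h

/-- Two disjoint rays with adjacent first vertices form a double ray. -/
def DoubleRay.glue (R S : Ray G) (hdisj : ∀ m n, R.toFun m ≠ S.toFun n)
    (h : G.Adj (R.toFun 0) (S.toFun 0)) : DoubleRay G where
  toFun
    | Int.ofNat n => S.toFun n
    | Int.negSucc n => R.toFun n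
  injective := by
    rintro (m | m) (n | n) hmn
    · exact congrArg _ (S.injective hmn)
    · exact absurd hmn.symm (hdisj _ _)
    · exact absurd hmn (hdisj _ _)
    · exact congrArg _ (R.injective hmn)
  adj := by
    rintro (n | n)
    · exact S.adj n
    · cases n with
      | zero => exact h
      | succ n => exact (R.adj n).symm

/-- Tails in different components of some `G - X` are disjoint. Leave the first tail for the last
time along a connecting walk; the rest of the walk and the second tail form a connected set disjoint
from the first tail, and a ray found there can be glued on. -/
theorem ConnSet.exists_doubleRay {A : Set V} (hA : ConnSet G A) {R S : Ray G}
    (hR : ∀ n, R.toFun n ∈ A) (hS : ∀ n, S.toFun n ∈ A) (hne : R.toEnd ≠ S.toEnd) :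
    ∃ D : DoubleRay G, (∀ n, D.toFun n ∈ A) ∧ D.negRay.toEnd = R.toEnd ∧
      D.posRay.toEnd = S.toEnd := by
  obtain ⟨X, hX⟩ := EndSpace.exists_comp_ne hne
  obtain ⟨M, hM⟩ := R.eventually_mem X
  obtain ⟨N, hN⟩ := S.eventually_mem X
  let R' := R.drop M
  let S' := S.drop N
  have hdisj : ∀ m n, R'.toFun m ≠ S'.toFun n := fun m n h => hX
    (ComponentCompl.eq_of_mem (hM (M + m) (by omega)) (h ▸ hN (N + n) (by omega)))
  obtain ⟨p, hp⟩ := hA (R'.toFun 0) (hR _) (S'.toFun 0) (hS _)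
  obtain ⟨_, ⟨k, rfl⟩, y, hxy, q, hq, hq'⟩ := exists_crossing (S := Set.range R'.toFun) p
    ⟨_, p.start_mem_support, 0, rfl⟩ (by rintro ⟨m, hm⟩; exact hdisj _ _ hm)
  have hB : ConnSet G ({x | x ∈ q.support} ∪ Set.range S'.toFun) :=
    (connSet_support q).union S'.connSet (v := S'.toFun 0) q.end_mem_support ⟨0, rfl⟩
  obtain ⟨T, hT0, hTB, hTS⟩ := hB.exists_ray_from (R := S') (fun n => Or.inr ⟨n, rfl⟩)
    (Or.inl q.start_mem_support)
  have hRT : ∀ m n, (R'.drop k).toFun m ≠ T.toFun n := by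
    intro m n h
    rcases hTB n with h' | ⟨j, hj⟩
    · exact hq' _ h' ⟨k + m, h⟩
    · exact hdisj _ _ (h.trans hj.symm)
  have hTA : ∀ n, T.toFun n ∈ A := fun n => by
    rcases hTB n with h' | ⟨j, hj⟩
    · exact hp _ (hq _ h')
    · exact hj ▸ hS _
  let D := DoubleRay.glue (R'.drop k) T hRT (by rw [hT0]; exact hxy)
  refine ⟨D, ?_, ?_, ?_⟩
  · rintro (n | n)
    · exact hTA n
    · exact hR _
  -- `D.negRay` starts at the first vertex of `T`, so it agrees with the tail of `R` only from index
  -- 1 on.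
  · rw [← Ray.toEnd_drop D.negRay 1, ← Ray.toEnd_drop R M, ← Ray.toEnd_drop (R.drop M) k]
    refine congrArg Ray.toEnd (Ray.ext fun n => ?_)
    simp only [Ray.drop, DoubleRay.negRay]
    rw [show (-((1 + n : ℕ) : ℤ)) = Int.negSucc n by rw [Int.negSucc_eq]; push_cast; ring]
    rfl
  · have : D.posRay = T := rfl
    rw [this, hTS, Ray.toEnd_drop]

/-! ### Domination -/

/-- A finite set without `v` meets only finitely many paths of the fan, so some path avoids `Y`
(except perhaps in `v`) and ends far out on the ray; take its second vertex. Working with a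
neighbour allows `v ∈ Y`. -/
theorem Dominates.exists_adj {v : V} {ω : EndSpace G} (h : Dominates v ω) (Y : Finset V) :
    ∃ c ∈ ω.comp Y, G.Adj v c := by
  classical
  obtain ⟨R, rfl, w, p, hpath, hmeet, hfan⟩ := h
  obtain ⟨N, hN⟩ := R.eventually_mem Y
  have hwmem : ∀ n, w n ∈ {x | x ∈ (p n).support} ∩ (Set.range R.toFun \ {v}) := fun n => by
    rw [hmeet n]; rfl
  let Z : Finset V := (Y ∪ (Finset.range N).image R.toFun).erase v
  have hbad : ∀ z ∈ Z, {n | z ∈ (p n).support}.Subsingleton := by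
    intro z hz m hm n hn
    by_contra hmn
    exact (Finset.ne_of_mem_erase hz) (hfan m n hmn z hm hn)
  have hfin : (⋃ z ∈ Z, {n | z ∈ (p n).support}).Finite :=
    Set.Finite.biUnion Z.finite_toSet fun z hz => (hbad z hz).finite
  obtain ⟨n, hn⟩ := hfin.exists_notMem
  simp only [Set.mem_iUnion, Set.mem_ofPred_eq, not_exists] at hn
  obtain ⟨hwp, ⟨m, hm⟩, hwv⟩ := hwmem n
  have hmN : N ≤ m := by
    by_contra! hlt
    exact hn (w n) (Finset.mem_erase.2 ⟨hwv, Finset.mem_union_right _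
      (Finset.mem_image.2 ⟨m, Finset.mem_range.2 hlt, hm⟩)⟩) hwp
  have hwC : w n ∈ R.toEnd.comp Y := hm ▸ hN m hmN
  obtain ⟨u, q, huC, huv, hpn, hn'⟩ : ∃ u, ∃ q : G.Walk v u, u ∈ R.toEnd.comp Y ∧ u ≠ v ∧
      q.IsPath ∧ ∀ x ∈ q.support, x ≠ v → x ∉ Y :=
    ⟨_, p n, hwC, hwv, hpath n, fun x hx hxv hxY =>
      hn x (Finset.mem_erase.2 ⟨hxv, Finset.mem_union_left _ hxY⟩) hx⟩
  cases q with
  | nil => exact absurd rfl huv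
  | @cons _ c _ h q =>
    rw [SimpleGraph.Walk.cons_isPath_iff] at hpn
    refine ⟨c, mem_component_of_walk _ q.reverse (fun x hx => ?_) huC, h⟩
    have hx' : x ∈ q.support := by simpa using hx
    exact hn' x (by simp [hx']) (fun hxv => hpn.2 (hxv ▸ hx'))

theorem Dominates.mem_comp {v : V} {ω : EndSpace G} (h : Dominates v ω) {Y : Finset V}
    (hv : v ∉ Y) : v ∈ ω.comp Y := by
  obtain ⟨c, hc, hvc⟩ := h.exists_adj Y
  exact SimpleGraph.ComponentCompl.mem_of_adj _ _ hc hv hvc.symm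

/-- The fan is built greedily: delete all earlier paths except `v`, walk from `v` to the ray in what
remains, and stop at the first vertex of the ray other than `v`. -/
theorem dominates_of_forall_mem_comp {v : V} {ω : EndSpace G}
    (h : ∀ Y : Finset V, v ∉ Y → v ∈ ω.comp Y) : Dominates v ω := by
  classical
  obtain ⟨R, rfl⟩ := ω.exists_ray
  let P : (Σ w, G.Walk v w) → Prop := fun q => q.2.IsPath ∧
    {x | x ∈ q.2.support} ∩ (Set.range R.toFun \ {v}) = {q.1}
  obtain ⟨f, hf, hr⟩ := exists_seq_of_forall_finset_exists P
    (fun q q' => ∀ x, x ∈ q.2.support → x ∈ q'.2.support → x = v) (by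
      intro s _
      let Y : Finset V := (s.biUnion fun q => q.2.support.toFinset).erase v
      have hvY : v ∈ R.toEnd.comp Y := h Y (Finset.notMem_erase _ _)
      obtain ⟨N, hN⟩ := R.eventually_mem Y
      obtain ⟨n, hn, hnv⟩ : ∃ n ≥ N, R.toFun n ≠ v := by
        by_contra! hc
        have := R.injective ((hc N le_rfl).trans (hc (N + 1) (Nat.le_succ _)).symm)
        omega
      obtain ⟨p, hp⟩ := exists_walk_of_mem_component _ hvY (hN n hn)
      obtain ⟨w, hw, q, hqp, hqw⟩ := exists_walk_first_hit (S := Set.range R.toFun \ {v}) p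
        ⟨⟨n, rfl⟩, hnv⟩
      refine ⟨⟨w, q.bypass⟩, ⟨q.bypass_isPath, ?_⟩, ?_⟩
      · ext x
        constructor
        · rintro ⟨hx, hxS⟩
          exact hqw x (q.support_bypass_subset_support hx) hxS
        · rintro rfl
          exact ⟨SimpleGraph.Walk.end_mem_support _, hw⟩
      · intro q' hq' x hx hx'
        by_contra hxv
        refine hp x (hqp x (q.support_bypass_subset_support hx')) ?_
        exact Finset.mem_coe.2 (Finset.mem_erase.2 ⟨hxv, Finset.mem_biUnion.2
          ⟨q', hq', by simpa using hx⟩⟩))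
  refine ⟨R, rfl, fun n => (f n).1, fun n => (f n).2, fun n => (hf n).1, fun n => (hf n).2, ?_⟩
  intro m n hmn x hm hn
  rcases lt_or_gt_of_ne hmn with hlt | hlt
  · exact hr m n hlt x hm hn
  · exact hr n m hlt x hn hm

/-! ### Generalised paths -/

/-- The set `A` contains a ray of `ω` or a vertex dominating `ω`. -/
def Reaches (A : Set V) (ω : EndSpace G) : Prop :=
  (∃ R : Ray G, R.toEnd = ω ∧ ∀ n, R.toFun n ∈ A) ∨ ∃ v ∈ A, Dominates v ω

theorem Reaches.mono {A B : Set V} {ω : EndSpace G} (h : Reaches A ω) (hAB : A ⊆ B) :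
    Reaches B ω :=
  h.imp (fun ⟨R, hR, hA⟩ => ⟨R, hR, fun n => hAB (hA n)⟩) fun ⟨v, hv, hd⟩ => ⟨v, hAB hv, hd⟩

theorem Reaches.exists_mem_comp {A : Set V} {ω : EndSpace G} (h : Reaches A ω) {X : Finset V}
    (hX : ∀ a ∈ A, a ∉ X) : ∃ a ∈ A, a ∈ ω.comp X := by
  rcases h with ⟨R, rfl, hR⟩ | ⟨v, hv, hd⟩
  · obtain ⟨N, hN⟩ := R.eventually_mem X
    exact ⟨_, hR N, hN N le_rfl⟩
  · exact ⟨v, hv, hd.mem_comp (hX v hv)⟩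

theorem DoubleRay.connSet (D : DoubleRay G) : ConnSet G (Set.range D.toFun) := by
  have : Set.range D.toFun = Set.range D.posRay.toFun ∪ Set.range D.negRay.toFun := by
    ext x
    constructor
    · rintro ⟨n, rfl⟩
      obtain ⟨k, rfl | rfl⟩ := n.eq_nat_or_neg
      · exact Or.inl ⟨k, rfl⟩
      · exact Or.inr ⟨k, rfl⟩
    · rintro (⟨k, rfl⟩ | ⟨k, rfl⟩)
      · exact ⟨_, rfl⟩
      · exact ⟨_, rfl⟩
  rw [this]
  exact D.posRay.connSet.union D.negRay.connSet (v := D.toFun 0) ⟨0, rfl⟩ ⟨0, rfl⟩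

/-- This treats the three kinds of generalised path uniformly: later arguments mostly need only a
countable connected set reaching two ends. -/
theorem GeneralisedPath.spec (P : GeneralisedPath G) :
    ConnSet G P.path.verts ∧ P.path.verts.Countable ∧ P.path.verts.Nonempty ∧
      ∃ ω₁ ω₂ : EndSpace G, ω₁ ≠ ω₂ ∧ P.ends = {ω₁, ω₂} ∧ Reaches P.path.verts ω₁ ∧
        Reaches P.path.verts ω₂ := by
  obtain ⟨ω₁, ω₂, hne, he, ⟨D, hP, h₁, h₂⟩ | ⟨v, w, p, -, hP, h₁, h₂⟩ | ⟨R, hP, h₁, h₂⟩⟩ :=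
    P.isGeneralisedPath
  · have hv : P.path.verts = Set.range D.toFun := by rw [hP]; rfl
    rw [hv]
    exact ⟨D.connSet, Set.countable_range _, ⟨_, 0, rfl⟩, ω₁, ω₂, hne, he,
      Or.inl ⟨_, h₁, fun n => ⟨_, rfl⟩⟩, Or.inl ⟨_, h₂, fun n => ⟨_, rfl⟩⟩⟩
  · have hv : P.path.verts = {x | x ∈ p.support} := by
      rw [hP, SimpleGraph.Walk.verts_toSubgraph]
    rw [hv]
    exact ⟨connSet_support p, (List.finite_toSet _).countable, ⟨_, p.start_mem_support⟩, ω₁, ω₂,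
      hne, he, Or.inr ⟨v, p.start_mem_support, h₁⟩, Or.inr ⟨w, p.end_mem_support, h₂⟩⟩
  · have hv : P.path.verts = Set.range R.toFun := by rw [hP]; rfl
    rw [hv]
    exact ⟨R.connSet, Set.countable_range _, ⟨_, 0, rfl⟩, ω₁, ω₂, hne, he,
      Or.inl ⟨_, h₁, fun n => ⟨_, rfl⟩⟩, Or.inr ⟨_, ⟨0, rfl⟩, h₂⟩⟩

theorem GeneralisedPath.reaches (P : GeneralisedPath G) {ω : EndSpace G} (h : ω ∈ P.ends) :
    Reaches P.path.verts ω := by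
  obtain ⟨-, -, -, ω₁, ω₂, -, he, h₁, h₂⟩ := P.spec
  rw [he] at h
  rcases h with rfl | rfl
  · exact h₁
  · exact h₂

theorem GeneralisedPath.meets_separator (P : GeneralisedPath G) {ω η : EndSpace G}
    (hω : ω ∈ P.ends) (hη : η ∈ P.ends) {X : Finset V} (hX : ω.comp X ≠ η.comp X) :
    ∃ x ∈ P.path.verts, x ∈ X := by
  by_contra! h
  obtain ⟨a, ha, haω⟩ := (P.reaches hω).exists_mem_comp h
  obtain ⟨b, hb, hbη⟩ := (P.reaches hη).exists_mem_comp h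
  exact hX (ComponentCompl.eq_of_mem
    (P.spec.1.subset_component (X := (X : Set V)) h _ ha haω b hb) hbη)

theorem GeneralisedPath.exists_pair (P : GeneralisedPath G) :
    ∃ ω η : EndSpace G, ω ≠ η ∧ P.ends = {ω, η} := by
  obtain ⟨-, -, -, ω, η, h, he, -⟩ := P.spec
  exact ⟨ω, η, h, he⟩

theorem GeneralisedPath.exists_pair_of_mem (P : GeneralisedPath G) {ω : EndSpace G}
    (h : ω ∈ P.ends) : ∃ η : EndSpace G, η ≠ ω ∧ P.ends = {ω, η} := by
  obtain ⟨ω₁, ω₂, hne, he⟩ := P.exists_pair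
  rw [he] at h
  rcases h with rfl | rfl
  · exact ⟨ω₂, hne.symm, he⟩
  · exact ⟨ω₁, hne, by rw [he, Set.pair_comm]⟩

theorem ConnSet.exists_doubleRay_generalisedPath {A : Set V} (hA : ConnSet G A) {R S : Ray G}
    (hR : ∀ n, R.toFun n ∈ A) (hS : ∀ n, S.toFun n ∈ A) (hne : R.toEnd ≠ S.toEnd) :
    ∃ P : GeneralisedPath G, P.ends = {R.toEnd, S.toEnd} ∧ P.path.verts ⊆ A ∧
      ∃ D : DoubleRay G, P.path = D.toSubgraph := by
  obtain ⟨D, hD, h₁, h₂⟩ := hA.exists_doubleRay hR hS hne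
  refine ⟨⟨D.toSubgraph, {R.toEnd, S.toEnd}, _, _, hne, rfl, Or.inl ⟨D, rfl, h₁, h₂⟩⟩, rfl, ?_,
    D, rfl⟩
  rintro _ ⟨n, rfl⟩
  exact hD n

theorem ConnSet.exists_ray_generalisedPath {A : Set V} (hA : ConnSet G A) {R : Ray G}
    (hR : ∀ n, R.toFun n ∈ A) {v : V} (hv : v ∈ A) {ω : EndSpace G} (hd : Dominates v ω)
    (hne : R.toEnd ≠ ω) :
    ∃ P : GeneralisedPath G, P.ends = {R.toEnd, ω} ∧ P.path.verts ⊆ A ∧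
      IsRayBetween P.path R.toEnd ω := by
  obtain ⟨S, hS0, hSA, hSR⟩ := hA.exists_ray_from hR hv
  have hb : IsRayBetween S.toSubgraph R.toEnd ω := ⟨S, rfl, hSR, hS0.symm ▸ hd⟩
  refine ⟨⟨S.toSubgraph, {R.toEnd, ω}, _, _, hne, rfl, Or.inr (Or.inr hb)⟩, rfl, ?_, hb⟩
  rintro _ ⟨n, rfl⟩
  exact hSA n

theorem ConnSet.exists_generalisedPath {A : Set V} (hA : ConnSet G A) {R : Ray G}
    (hR : ∀ n, R.toFun n ∈ A) {ω : EndSpace G} (hω : Reaches A ω) (hne : R.toEnd ≠ ω) :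
    ∃ P : GeneralisedPath G, P.path.verts ⊆ A := by
  rcases hω with ⟨S, rfl, hS⟩ | ⟨v, hv, hd⟩
  · obtain ⟨P, -, h, -⟩ := hA.exists_doubleRay_generalisedPath hR hS hne
    exact ⟨P, h⟩
  · obtain ⟨P, -, h, -⟩ := hA.exists_ray_generalisedPath hR hv hd hne
    exact ⟨P, h⟩

/-! ### Ends that are limits of the boundary of a set -/

/-- Every neighbourhood `C(Y, ω)` of `ω` meets the boundary of `D`. -/
def BoundaryLimit (D : Set V) (ω : EndSpace G) : Prop :=
  ∀ Y : Finset V, ∃ a ∈ boundary G D, a ∈ ω.comp Y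

/-- The connected set `C(Y, ω)` contains vertices of `R` outside `D`. It also contains a vertex of
`D`, and hence a boundary vertex, unless a neighbour of a dominating vertex is already a boundary
vertex in it. -/
theorem Reaches.boundaryLimit {D : Set V} {ω : EndSpace G} (h : Reaches D ω) {R : Ray G}
    (hR : R.toEnd = ω) (hRD : ∀ N, ∃ n ≥ N, R.toFun n ∉ D) : BoundaryLimit D ω := by
  intro Y
  subst hR
  obtain ⟨c, hc, hcD⟩ : ∃ c ∈ R.toEnd.comp Y, c ∈ D ∨ c ∈ boundary G D := by
    rcases h with ⟨S, hS, hSD⟩ | ⟨v, hv, hd⟩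
    · rw [← hS]
      obtain ⟨N, hN⟩ := S.eventually_mem Y
      exact ⟨_, hN N le_rfl, Or.inl (hSD N)⟩
    · obtain ⟨c, hc, hvc⟩ := hd.exists_adj Y
      by_cases hcD : c ∈ D
      · exact ⟨c, hc, Or.inl hcD⟩
      · exact ⟨c, hc, Or.inr ⟨hcD, v, hv, hvc⟩⟩
  rcases hcD with hcD | hcD
  · obtain ⟨N, hN⟩ := R.eventually_mem Y
    obtain ⟨n, hn, hnD⟩ := hRD N
    obtain ⟨a, ha, haD⟩ := (ComponentCompl.connSet (R.toEnd.comp Y)).inter_boundary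
      hc hcD (hN n hn) hnD
    exact ⟨a, haD, ha⟩
  · exact ⟨c, hcD, hc⟩

/-! ### Walk-closed sets and the star–comb argument. -/

/-- Two vertices of `U` that can be joined in `G` while avoiding a finite subset of `U` can be
joined inside `U` while avoiding it. -/
def WalkClosed (G : SimpleGraph V) (U : Set V) : Prop :=
  ∀ X : Finset V, (X : Set V) ⊆ U → ∀ a ∈ U, ∀ b ∈ U,
    (∃ p : G.Walk a b, ∀ x ∈ p.support, x ∉ X) → ∃ p : G.Walk a b, ∀ x ∈ p.support, x ∈ U ∧ x ∉ X

theorem exists_walkClosed {W : Set V} (hW : W.Countable) :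
    ∃ U, W ⊆ U ∧ U.Countable ∧ WalkClosed G U := by
  classical
  have hw : ∀ (X : Finset V) (a b : V), ∃ S : Set V, S.Countable ∧
      ((∃ p : G.Walk a b, ∀ x ∈ p.support, x ∉ X) →
        ∃ p : G.Walk a b, ∀ x ∈ p.support, x ∈ S ∧ x ∉ X) := by
    intro X a b
    by_cases h : ∃ p : G.Walk a b, ∀ x ∈ p.support, x ∉ X
    · obtain ⟨p, hp⟩ := h
      exact ⟨{x | x ∈ p.support}, (List.finite_toSet _).countable, fun _ => ⟨p, fun x hx =>
        ⟨hx, hp x hx⟩⟩⟩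
    · exact ⟨∅, Set.countable_empty, fun h' => absurd h' h⟩
  choose S hSc hS using hw
  -- Add one witnessing walk for each of the countably many triples `(X, a, b)` in `U`; iterating
  -- countably often closes the set, as each triple is finite and appears at some stage.
  let step : Set V → Set V := fun U => U ∪ ⋃ (X : Finset U) (a : U) (b : U),
    S (X.map (Function.Embedding.subtype _)) a b
  let T : ℕ → Set V := fun n => step^[n] W
  have hTs : ∀ n, T (n + 1) = step (T n) := fun n => Function.iterate_succ_apply' step n W
  have hTc : ∀ n, (T n).Countable := by
    intro n
    induction n with
    | zero => exact hW
    | succ n ih =>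
      rw [hTs]
      have : Countable (T n) := ih.to_subtype
      exact ih.union (Set.countable_iUnion fun X => Set.countable_iUnion fun a =>
        Set.countable_iUnion fun b => hSc _ _ _)
  have hTm : Monotone T := monotone_nat_of_le_succ fun n => by
    rw [hTs]; exact Set.subset_union_left
  refine ⟨⋃ n, T n, Set.subset_iUnion T 0, Set.countable_iUnion hTc, ?_⟩
  intro X hX a ha b hb hab
  have hfin : ∃ n, ((insert a (insert b X) : Finset V) : Set V) ⊆ T n := by
    refine hTm.directed_le.exists_mem_subset_of_finset_subset_biUnion fun x hx => ?_
    simp only [Finset.coe_insert, Set.mem_insert_iff] at hx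
    rcases hx with rfl | rfl | hx
    exacts [ha, hb, hX hx]
  obtain ⟨n, hn⟩ := hfin
  obtain ⟨p, hp⟩ := hS X a b hab
  refine ⟨p, fun x hx => ⟨Set.mem_iUnion.2 ⟨n + 1, ?_⟩, (hp x hx).2⟩⟩
  rw [hTs]
  refine Or.inr (Set.mem_iUnion.2 ⟨X.subtype (· ∈ T n), Set.mem_iUnion.2
    ⟨⟨a, hn (by simp)⟩, Set.mem_iUnion.2 ⟨⟨b, hn (by simp)⟩, ?_⟩⟩⟩)
  have hXe : (X.subtype (· ∈ T n)).map (Function.Embedding.subtype _) = X :=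
    Finset.subtype_map_of_mem fun x hx => hn (by simp [hx])
  change x ∈ S ((X.subtype (· ∈ T n)).map (Function.Embedding.subtype _)) a b
  rw [hXe]
  exact (hp x hx).1

/-- All but finitely many boundary vertices of a component of `G - U` lie in the same component
of `G - Y`. -/
theorem boundary_mem_comp {U : Set V} (hU : WalkClosed G U) (D : G.ComponentCompl U)
    {Y : Finset V} {a b : V} (ha : a ∈ boundary G (D : Set V)) (hb : b ∈ boundary G (D : Set V))
    {ω : EndSpace G} (haY : a ∈ ω.comp Y) (hbY : b ∉ Y) : b ∈ ω.comp Y := by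
  classical
  have haU := ComponentCompl.boundary_subset D ha
  have hbU := ComponentCompl.boundary_subset D hb
  obtain ⟨-, c, hc, hca⟩ := ha
  obtain ⟨-, d, hd, hdb⟩ := hb
  obtain ⟨p, hp⟩ := ComponentCompl.connSet D c hc d hd
  -- The walk through `D` may meet `Y`, but not `Y ∩ U`. Rerouted inside `U`, it avoids all of `Y`.
  obtain ⟨q, hq⟩ := hU (Y.filter (· ∈ U)) (by intro x; simp) a haU b hbU
    ⟨.cons hca.symm (p.concat hdb), fun x hx => by
      simp only [SimpleGraph.Walk.support_cons, SimpleGraph.Walk.support_concat, List.mem_cons,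
        List.mem_append, List.not_mem_nil, or_false] at hx
      rintro hxY
      rw [Finset.mem_filter] at hxY
      rcases hx with rfl | hx | rfl
      · exact ComponentCompl.notMem _ haY hxY.1
      · exact ComponentCompl.notMem _ (hp x hx) hxY.2
      · exact hbY hxY.1⟩
  exact mem_component_of_walk _ q (fun x hx hxY => (hq x hx).2 (by
    rw [Finset.mem_filter]; exact ⟨hxY, (hq x hx).1⟩)) haY

theorem BoundaryLimit.unique {U : Set V} (hU : WalkClosed G U) {D : G.ComponentCompl U}
    {ω η : EndSpace G} (hω : BoundaryLimit (D : Set V) ω) (hη : BoundaryLimit (D : Set V) η) :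
    ω = η := by
  refine EndSpace.ext fun Y => ?_
  obtain ⟨a, ha, haω⟩ := hω Y
  obtain ⟨b, hb, hbη⟩ := hη Y
  exact ComponentCompl.eq_of_mem
    (boundary_mem_comp hU D ha hb haω (ComponentCompl.notMem _ hbη)) hbη

/-- If a connected set `E` attaches to infinitely many vertices of `B`, and a finite set separates
the vertex `f` from almost all of `B`, then a connected subset of `E` without `f` attaches to
infinitely many vertices of `B`. -/
theorem ConnSet.exists_infinite_attachments {E B : Set V} (hE : ConnSet G E)
    (hinf : {a ∈ B | ∃ e ∈ E, G.Adj e a}.Infinite) {f : V}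
    (hf : f ∈ E → ∃ Y : Finset V, f ∉ Y ∧ ∀ a ∈ B, a ∉ Y →
      ¬ ∃ p : G.Walk f a, ∀ x ∈ p.support, x ∉ Y) :
    ∃ E' ⊆ E, f ∉ E' ∧ ConnSet G E' ∧ {a ∈ B | ∃ e ∈ E', G.Adj e a}.Infinite := by
  classical
  by_cases hfE : f ∈ E
  swap
  · exact ⟨E, subset_rfl, hfE, hE, hinf⟩
  obtain ⟨Y, hfY, hY⟩ := hf hfE
  by_contra! hcon
  -- `K x` is the component of `x` in `E - f`. If each attaches to only finitely many vertices of
  -- `B`, some attachment `a` avoids `Y` and all components meeting `Y`, so `f` can be joined to `a`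
  -- off `Y`.
  let K : V → Set V := fun x => {y | ∃ p : G.Walk x y, ∀ z ∈ p.support, z ∈ E ∧ z ≠ f}
  have hKE : ∀ x, K x ⊆ E := fun x y ⟨p, hp⟩ => (hp y p.end_mem_support).1
  have hKf : ∀ x, f ∉ K x := fun x ⟨p, hp⟩ => (hp f p.end_mem_support).2 rfl
  have hKsupp : ∀ x y (p : G.Walk x y), (∀ z ∈ p.support, z ∈ E ∧ z ≠ f) →
      ∀ z ∈ p.support, z ∈ K x := fun x y p hp z hz =>
    ⟨p.takeUntil z hz, fun w hw => hp w (p.support_takeUntil_subset_support hz hw)⟩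
  have hKc : ∀ x, ConnSet G (K x) := by
    rintro x a ⟨p, hp⟩ b ⟨q, hq⟩
    refine ⟨p.reverse.append q, fun z hz => ?_⟩
    rw [SimpleGraph.Walk.mem_support_append_iff] at hz
    rcases hz with hz | hz
    · exact hKsupp x a p hp z (by simpa using hz)
    · exact hKsupp x b q hq z hz
  have hfin : ∀ x, {a ∈ B | ∃ e ∈ K x, G.Adj e a}.Finite := fun x =>
    hcon (K x) (hKE x) (hKf x) (hKc x)
  have hbad : ((Y : Set V) ∪ ⋃ y ∈ Y, {a ∈ B | ∃ e ∈ K y, G.Adj e a}).Finite :=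
    Y.finite_toSet.union (Y.finite_toSet.biUnion fun y _ => hfin y)
  obtain ⟨a, ⟨haB, e, he, hea⟩, ha⟩ := (hinf.sdiff hbad).nonempty
  rw [Set.mem_union, not_or] at ha
  have haY : a ∉ Y := ha.1
  have ha' : ∀ y ∈ Y, ∀ e ∈ K y, ¬ G.Adj e a := fun y hy e he hadj => ha.2
    (Set.mem_iUnion₂.2 ⟨y, hy, haB, e, he, hadj⟩)
  refine hY a haB haY ?_
  by_cases hef : e = f
  · subst hef
    refine ⟨.cons hea .nil, fun x hx => ?_⟩
    simp only [SimpleGraph.Walk.support_cons, SimpleGraph.Walk.support_nil, List.mem_cons,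
      List.not_mem_nil, or_false] at hx
    rcases hx with rfl | rfl
    · exact hfY
    · exact haY
  · obtain ⟨p, hp⟩ := hE f hfE e he
    obtain ⟨x, rfl, y, hxy, q, hq, hqf⟩ := exists_crossing (S := {f}) p
      ⟨f, p.start_mem_support, rfl⟩ hef
    refine ⟨.cons hxy (q.concat hea), fun z hz => ?_⟩
    simp only [SimpleGraph.Walk.support_cons, SimpleGraph.Walk.support_concat, List.mem_cons,
      List.mem_append, List.not_mem_nil, or_false] at hz
    rcases hz with rfl | hz | rfl
    · exact hfY
    · intro hzY
      refine ha' z hzY e ⟨q.dropUntil z hz, fun w hw => ?_⟩ hea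
      have hw' := q.support_dropUntil_subset_support hz hw
      exact ⟨hp w (hq w hw'), fun h => hqf w hw' h⟩
    · exact haY

theorem ConnSet.exists_countable_subset {D : Set V} (hD : ConnSet G D) {d : ℕ → V}
    (hd : ∀ n, d n ∈ D) : ∃ E ⊆ D, E.Countable ∧ ConnSet G E ∧ ∀ n, d n ∈ E := by
  choose p hp using fun n => hD (d 0) (hd 0) (d n) (hd n)
  have hmem : ∀ n, ∀ x ∈ (p n).support, x ∈ ⋃ n, {x | x ∈ (p n).support} :=
    fun n x hx => Set.mem_iUnion.2 ⟨n, hx⟩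
  refine ⟨⋃ n, {x | x ∈ (p n).support}, Set.iUnion_subset fun n x hx => hp n x hx,
    Set.countable_iUnion fun n => (List.finite_toSet _).countable, ?_,
    fun n => hmem n _ (p n).end_mem_support⟩
  intro a ha b hb
  obtain ⟨m, hm⟩ := Set.mem_iUnion.1 ha
  obtain ⟨n, hn⟩ := Set.mem_iUnion.1 hb
  obtain ⟨q, hq⟩ := (connSet_support (p m)).union (connSet_support (p n))
    (v := d 0) (p m).start_mem_support (p n).start_mem_support a (Or.inl hm) b (Or.inr hn)
  exact ⟨q, fun x hx => (hq x hx).elim (hmem m x) (hmem n x)⟩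

theorem Finset.exists_disjoint_of_antitone {E : ℕ → Set V} (hE : Antitone E)
    (hempty : ∀ v, ∃ n, v ∉ E n) (Y : Finset V) : ∃ n, ∀ y ∈ Y, y ∉ E n := by
  choose n hn using hempty
  exact ⟨Y.sup n, fun y hy h => hn y (hE (Finset.le_sup hy) h)⟩

/-- A star–comb lemma: if the boundary of a component `D` of `G - U` converges to the end `ω`, then
`D` contains a ray of `ω` or a vertex that dominates `ω`. -/
theorem BoundaryLimit.reaches {U : Set V} (hU : WalkClosed G U) {D : G.ComponentCompl U}
    {ω : EndSpace G} (h : BoundaryLimit (D : Set V) ω) : Reaches (D : Set V) ω := by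
  classical
  by_contra hno
  rw [Reaches, not_or] at hno
  obtain ⟨hnoray, hnodom⟩ := hno
  push Not at hnodom
  let B := boundary G (D : Set V)
  have hBω : ∀ Y : Finset V, ∀ a ∈ B, a ∉ Y → a ∈ ω.comp Y := fun Y a ha haY => by
    obtain ⟨b, hb, hbω⟩ := h Y
    exact boundary_mem_comp hU D hb ha hbω haY
  have hBinf : B.Infinite := fun hfin => by
    obtain ⟨a, ha, haω⟩ := h hfin.toFinset
    exact ComponentCompl.notMem _ haω (by simpa using ha)
  have hsep : ∀ f ∈ (D : Set V), ∃ Y : Finset V, f ∉ Y ∧ ∀ a ∈ B, a ∉ Y →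
      ¬ ∃ p : G.Walk f a, ∀ x ∈ p.support, x ∉ Y := by
    intro f hf
    have : ∃ Y : Finset V, f ∉ Y ∧ f ∉ ω.comp Y := by
      by_contra! hc
      exact hnodom f hf (dominates_of_forall_mem_comp hc)
    obtain ⟨Y, hfY, hfω⟩ := this
    refine ⟨Y, hfY, fun a ha haY ⟨p, hp⟩ => hfω ?_⟩
    exact mem_component_of_walk _ p.reverse
      (fun x hx => by simpa using hp x (by simpa using hx)) (hBω Y a ha haY)
  let a := hBinf.natEmbedding
  choose d hdD hda using fun n => (a n).2.2
  obtain ⟨E₀, hE₀D, hE₀c, hE₀conn, hE₀d⟩ := (ComponentCompl.connSet D).exists_countable_subset hdD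
  have hE₀inf : {a ∈ B | ∃ e ∈ E₀, G.Adj e a}.Infinite := by
    refine Set.infinite_of_injective_forall_mem (f := fun n => (a n : V))
      (Subtype.val_injective.comp a.injective) fun n => ⟨(a n).2, d n, hE₀d n, hda n⟩
  -- Since `E₀` is countable, its vertices can be discarded one by one, making the intersection
  -- empty while infinitely many attachments survive at each stage.
  obtain ⟨e, he⟩ := hE₀c.exists_eq_range ⟨_, hE₀d 0⟩
  let T := {E : Set V // E ⊆ D ∧ ConnSet G E ∧ {a ∈ B | ∃ e ∈ E, G.Adj e a}.Infinite}
  have hstep : ∀ (E : T) (f : V), ∃ E' : T, E'.1 ⊆ E.1 ∧ f ∉ E'.1 := by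
    rintro ⟨E, hED, hEc, hEi⟩ f
    obtain ⟨E', h₁, h₂, h₃, h₄⟩ := hEc.exists_infinite_attachments hEi
      (fun hf => hsep f (hED hf))
    exact ⟨⟨E', h₁.trans hED, h₃, h₄⟩, h₁, h₂⟩
  choose g hgsub hgnot using hstep
  let E : ℕ → T := fun n => Nat.rec ⟨E₀, hE₀D, hE₀conn, hE₀inf⟩ (fun k F => g F (e k)) n
  have hEs : ∀ n, E (n + 1) = g (E n) (e n) := fun n => rfl
  have hanti : Antitone fun n => (E n).1 := antitone_nat_of_succ_le fun n => by
    rw [hEs]; exact hgsub _ _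
  have hempty : ∀ v, ∃ n, v ∉ (E n).1 := by
    intro v
    by_cases hv : v ∈ E₀
    · rw [he] at hv
      obtain ⟨k, rfl⟩ := hv
      exact ⟨k + 1, by rw [hEs]; exact hgnot _ _⟩
    · exact ⟨0, hv⟩
  have hne : ∀ n, (E n).1.Nonempty := fun n => by
    obtain ⟨_, -, e, he, -⟩ := (E n).2.2.2.nonempty
    exact ⟨e, he⟩
  obtain ⟨R, -, hR0, hR⟩ := exists_ray_of_antitone (fun n => (E n).1) hanti
    (fun n => (E n).2.2.1) hne hempty (hE₀d 0)
  refine hnoray ⟨R, Ray.toEnd_eq_of_frequently fun Y N => ?_, fun n => hE₀D (hR0 n)⟩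
  obtain ⟨k, hk⟩ := Finset.exists_disjoint_of_antitone hanti hempty Y
  -- `E k` misses `Y` but attaches to a boundary vertex outside `Y`, which lies in `C(Y, ω)`; so all
  -- of `E k` lies there.
  obtain ⟨b, ⟨hbB, c, hc, hcb⟩, hbY⟩ := ((E k).2.2.2.sdiff Y.finite_toSet).nonempty
  have hcω : c ∈ ω.comp Y := SimpleGraph.ComponentCompl.mem_of_adj _ _ (hBω Y b hbB hbY)
    (fun h => hk c h hc) hcb.symm
  obtain ⟨M, hM⟩ := hR k
  exact ⟨max M N, le_max_right _ _, (E k).2.2.1.subset_component (X := (Y : Set V))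
    (fun x hx hxY => hk x hxY hx) _ hc hcω _ (hM _ (le_max_left _ _))⟩

/-! ### Countable sets meeting all generalised paths -/

theorem exists_maximal_pairwise {α : Type*} (s : Set α) (r : α → α → Prop) :
    ∃ t ⊆ s, t.Pairwise r ∧ ∀ q ∈ s, (∀ p ∈ t, r p q ∧ r q p) → q ∈ t := by
  obtain ⟨t, ht⟩ := zorn_subset {t | t ⊆ s ∧ t.Pairwise r} (by
    intro c hc hchain
    refine ⟨⋃₀ c, ⟨Set.sUnion_subset fun t ht => (hc ht).1,
      (Set.pairwise_sUnion hchain.directedOn).2 fun t ht => (hc ht).2⟩,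
      fun t ht => Set.subset_sUnion_of_mem ht⟩)
  refine ⟨t, ht.prop.1, ht.prop.2, fun q hq hqt => ?_⟩
  have : insert q t ∈ {t | t ⊆ s ∧ t.Pairwise r} :=
    ⟨Set.insert_subset hq ht.prop.1, ht.prop.2.insert fun p hp _ => ⟨(hqt p hp).2, (hqt p hp).1⟩⟩
  exact ht.le_of_ge this (Set.subset_insert q t) (Set.mem_insert q t)

theorem countable_verts {S : Set (GeneralisedPath G)} (hS : S.Countable) :
    (⋃ P ∈ S, P.path.verts).Countable :=
  hS.biUnion fun P _ => P.spec.2.1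

/-- If every family of pairwise vertex-disjoint and `r`-related members of `𝒮` is countable, then
some countable family cannot be extended by a vertex-disjoint member that is `r`-related to all. -/
theorem exists_countable_of_families (𝒮 : Set (GeneralisedPath G))
    (r : GeneralisedPath G → GeneralisedPath G → Prop) (hr : ∀ P Q, r P Q → r Q P)
    (h : ∀ S ⊆ 𝒮, S.Pairwise (fun P Q => P.VertexDisjoint Q ∧ r P Q) → S.Countable) :
    ∃ S ⊆ 𝒮, S.Countable ∧ ∀ Q ∈ 𝒮, (∀ P ∈ S, ∀ x ∈ P.path.verts, x ∉ Q.path.verts) →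
      ∃ P ∈ S, ¬ r P Q := by
  obtain ⟨S, hS, hp, hmax⟩ := exists_maximal_pairwise 𝒮 fun P Q => P.VertexDisjoint Q ∧ r P Q
  refine ⟨S, hS, h S hS hp, fun Q hQ hdisj => ?_⟩
  by_contra! hc
  have hQS : Q ∈ S := hmax Q hQ fun P hP => by
    have hd : Disjoint P.path.verts Q.path.verts := Set.disjoint_left.2 (hdisj P hP)
    exact ⟨⟨hd, hc P hP⟩, hd.symm, hr _ _ (hc P hP)⟩
  obtain ⟨x, hx⟩ := Q.spec.2.2.1
  exact hdisj Q hQS x hx hx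

theorem exists_countable_meeting_disjoint
    (h : ∀ S : Set (GeneralisedPath G), S.Pairwise GeneralisedPath.IsDisjoint → S.Countable) :
    ∃ (U : Set V) (Ψ : Set (EndSpace G)), U.Countable ∧ Ψ.Countable ∧
      ∀ Q : GeneralisedPath G, (∀ x ∈ Q.path.verts, x ∉ U) → ∃ ω ∈ Ψ, ω ∈ Q.ends := by
  obtain ⟨S, -, hSc, hS⟩ := exists_countable_of_families (G := G) Set.univ
    (fun P Q => Disjoint P.ends Q.ends) (fun _ _ h => h.symm) fun S _ hS => h S hS
  refine ⟨⋃ P ∈ S, P.path.verts, ⋃ P ∈ S, P.ends, countable_verts hSc,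
    hSc.biUnion fun P _ => ?_, fun Q hQ => ?_⟩
  · obtain ⟨ω, η, -, he⟩ := P.exists_pair
    rw [he]
    exact (Set.toFinite _).countable
  · obtain ⟨P, hP, hPQ⟩ := hS Q (Set.mem_univ _) fun P hP x hx hxQ =>
      hQ x hxQ (Set.mem_iUnion₂.2 ⟨P, hP, hx⟩)
    obtain ⟨ω, hω, hω'⟩ := Set.not_disjoint_iff.1 hPQ
    exact ⟨ω, Set.mem_iUnion₂.2 ⟨P, hP, hω⟩, hω'⟩

open Classical in
/-- The endpoint other than `ω` of a generalised path with endpoint `ω`. -/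
noncomputable def GeneralisedPath.otherEnd (ω : EndSpace G) (P : GeneralisedPath G) : EndSpace G :=
  if h : ∃ η, η ≠ ω ∧ P.ends = {ω, η} then h.choose else ω

theorem GeneralisedPath.otherEnd_spec {ω : EndSpace G} {P : GeneralisedPath G} (h : ω ∈ P.ends) :
    P.otherEnd ω ≠ ω ∧ P.ends = {ω, P.otherEnd ω} := by
  have h' := P.exists_pair_of_mem h
  rw [GeneralisedPath.otherEnd, dif_pos h']
  exact h'.choose_spec

theorem GeneralisedPath.otherEnd_eq {ω η : EndSpace G} {P : GeneralisedPath G}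
    (h : P.ends = {ω, η}) : P.otherEnd ω = η := by
  obtain ⟨h₁, h₂⟩ := P.otherEnd_spec (ω := ω) (by rw [h]; exact Set.mem_insert _ _)
  have : P.otherEnd ω ∈ P.ends := by rw [h₂]; exact Set.mem_insert_of_mem _ rfl
  rw [h] at this
  exact this.resolve_left h₁

/-- The generalised paths of a fixed type of which a sun with centre `ω` may consist are met by
countably many vertices. -/
theorem exists_countable_meeting_class {ω : EndSpace G} (𝒮 : Set (GeneralisedPath G))
    (h𝒮 : ∀ P ∈ 𝒮, ω ∈ P.ends)
    (h : ∀ S ⊆ 𝒮, IsGeneralisedStar S ω (GeneralisedPath.otherEnd ω) → S.Countable) :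
    ∃ W : Set V, W.Countable ∧ ∀ Q ∈ 𝒮, ∃ x ∈ Q.path.verts, x ∈ W := by
  have hX : ∀ η : EndSpace G, ∃ X : Finset V, η ≠ ω → ω.comp X ≠ η.comp X := fun η => by
    by_cases hη : η = ω
    · exact ⟨∅, fun h => absurd hη h⟩
    · obtain ⟨X, hX⟩ := EndSpace.exists_comp_ne (Ne.symm hη)
      exact ⟨X, fun _ => hX⟩
  choose X hX using hX
  obtain ⟨S, hSS, hSc, hS⟩ := exists_countable_of_families 𝒮
    (fun P Q => P.otherEnd ω ≠ Q.otherEnd ω) (fun _ _ h => h.symm) fun S hSS hp =>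
      h S hSS ⟨fun P hP => (GeneralisedPath.otherEnd_spec (h𝒮 P (hSS hP))).2,
        fun _ hP _ hQ hne => (hp hP hQ hne).1, fun P hP Q hQ he => by
          by_contra hne
          exact (hp hP hQ hne).2 he⟩
  -- A path disjoint from the maximal star `S` shares its other end with some member, so it meets
  -- the finite set chosen to separate that end from `ω`.
  refine ⟨(⋃ P ∈ S, P.path.verts) ∪ ⋃ P ∈ S, (X (P.otherEnd ω) : Set V),
    (countable_verts hSc).union (hSc.biUnion fun P _ => (X _).countable_toSet), fun Q hQ => ?_⟩
  by_contra! hc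
  obtain ⟨P, hP, hPQ⟩ := hS Q hQ fun P hP x hx hxQ =>
    hc x hxQ (Or.inl (Set.mem_iUnion₂.2 ⟨P, hP, hx⟩))
  rw [ne_eq, not_not] at hPQ
  obtain ⟨hne, he⟩ := Q.otherEnd_spec (h𝒮 Q hQ)
  obtain ⟨x, hxQ, hx⟩ := Q.meets_separator (h𝒮 Q hQ)
    (by rw [he]; exact Set.mem_insert_of_mem _ rfl) (hX _ hne)
  exact hc x hxQ (Or.inr (Set.mem_iUnion₂.2 ⟨P, hP, by rw [hPQ]; exact hx⟩))

/-- A path `Q` between `ω` and `η` avoiding `U` lies in a component `D` of `G - U`. A ray of `η` in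
`D` would give a path of sun type there, which `W₁` or `W₂` meets. So `η` is a limit of the boundary
of `D`. If `R ∈ ω` has no tail in `D`, then `ω` is such a limit too, contradicting uniqueness.
Otherwise `D` is the component containing a tail of `R`, which leaves a single candidate for `η`;
one more finite separator meets `Q`. -/
theorem exists_countable_meeting_end (ω : EndSpace G)
    (h : ∀ S : Set (GeneralisedPath G), IsSun S ω → S.Countable) :
    ∃ W : Set V, W.Countable ∧ ∀ Q : GeneralisedPath G, ω ∈ Q.ends → ∃ x ∈ Q.path.verts, x ∈ W := by
  obtain ⟨W₁, hW₁c, hW₁⟩ := exists_countable_meeting_class (ω := ω)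
    {P | ω ∈ P.ends ∧ ∃ D : DoubleRay G, P.path = D.toSubgraph} (fun P hP => hP.1)
    fun S hS hstar => h S ⟨_, hstar, Or.inl fun P hP => (hS hP).2⟩
  obtain ⟨W₂, hW₂c, hW₂⟩ := exists_countable_meeting_class (ω := ω)
    {P | ω ∈ P.ends ∧ IsRayBetween P.path (P.otherEnd ω) ω} (fun P hP => hP.1)
    fun S hS hstar => h S ⟨_, hstar, Or.inr fun P hP => (hS hP).2⟩
  obtain ⟨U, hWU, hUc, hU⟩ := exists_walkClosed (G := G) (hW₁c.union hW₂c)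
  obtain ⟨R, hR⟩ := ω.exists_ray
  let B : Set (EndSpace G) := {η | η ≠ ω ∧ ∃ D : G.ComponentCompl U,
    (∃ N, ∀ n ≥ N, R.toFun n ∈ D) ∧ BoundaryLimit (D : Set V) η}
  have hB : B.Subsingleton := by
    rintro η ⟨-, D, ⟨N, hN⟩, hη⟩ η' ⟨-, D', ⟨N', hN'⟩, hη'⟩
    obtain rfl : D = D' := ComponentCompl.eq_of_mem (hN (max N N') (le_max_left _ _))
      (hN' _ (le_max_right _ _))
    exact hη.unique hU hη'
  have hX : ∀ η : B, ∃ X : Finset V, ω.comp X ≠ η.1.comp X := fun η =>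
    EndSpace.exists_comp_ne (Ne.symm η.2.1)
  choose X hX using hX
  have : Countable B := hB.finite.countable.to_subtype
  refine ⟨U ∪ ⋃ η, (X η : Set V), hUc.union (Set.countable_iUnion fun η => (X η).countable_toSet),
    fun Q hQ => ?_⟩
  by_contra! hc
  have hQU : ∀ x ∈ Q.path.verts, x ∉ U := fun x hx hxU => hc x hx (Or.inl hxU)
  obtain ⟨η, hne, he⟩ := Q.exists_pair_of_mem hQ
  have hηQ : η ∈ Q.ends := by rw [he]; exact Set.mem_insert_of_mem _ rfl
  obtain ⟨x₀, hx₀⟩ := Q.spec.2.2.1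
  obtain ⟨D, hD⟩ := Q.spec.1.exists_component hQU hx₀
  have hωD : Reaches (D : Set V) ω := (Q.reaches hQ).mono hD
  have hηD : Reaches (D : Set V) η := (Q.reaches hηQ).mono hD
  have hDconn : ConnSet G (D : Set V) := ComponentCompl.connSet D
  have hDU : ∀ x ∈ (D : Set V), x ∉ U := fun x hx => ComponentCompl.notMem D hx
  by_cases hray : ∃ S : Ray G, S.toEnd = η ∧ ∀ n, S.toFun n ∈ (D : Set V)
  · obtain ⟨S, rfl, hS⟩ := hray
    rcases hωD with ⟨R', hR', hR'D⟩ | ⟨v, hv, hd⟩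
    · obtain ⟨P, hPe, hPD, hP⟩ := hDconn.exists_doubleRay_generalisedPath hR'D hS
        (by rw [hR']; exact hne.symm)
      obtain ⟨x, hx, hxW⟩ := hW₁ P ⟨by rw [hPe, hR']; exact Set.mem_insert _ _, hP⟩
      exact hDU x (hPD hx) (hWU (Or.inl hxW))
    · obtain ⟨P, hPe, hPD, hP⟩ := hDconn.exists_ray_generalisedPath hS hv hd hne
      rw [Set.pair_comm] at hPe
      obtain ⟨x, hx, hxW⟩ := hW₂ P ⟨by rw [hPe]; exact Set.mem_insert _ _, by
        rw [GeneralisedPath.otherEnd_eq hPe]; exact hP⟩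
      exact hDU x (hPD hx) (hWU (Or.inr hxW))
  · obtain ⟨S, hS⟩ := η.exists_ray
    have hηlim : BoundaryLimit (D : Set V) η := hηD.boundaryLimit hS fun N => by
      by_contra! hc'
      exact hray ⟨S.drop N, by rw [Ray.toEnd_drop, hS], fun n => hc' _ (by simp)⟩
    by_cases hRD : ∃ N, ∀ n ≥ N, R.toFun n ∈ (D : Set V)
    · let η' : B := ⟨η, hne, D, hRD, hηlim⟩
      obtain ⟨x, hx, hxX⟩ := Q.meets_separator hQ hηQ (hX η')
      exact hc x hx (Or.inr (Set.mem_iUnion.2 ⟨η', hxX⟩))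
    · push Not at hRD
      exact hne (hηlim.unique hU (hωD.boundaryLimit hR hRD))

theorem exists_countable_meeting
    (h₁ : ∀ (S : Set (GeneralisedPath G)) (ω : EndSpace G), IsSun S ω → S.Countable)
    (h₂ : ∀ S : Set (GeneralisedPath G), S.Pairwise GeneralisedPath.IsDisjoint → S.Countable) :
    ∃ U : Set V, U.Countable ∧ WalkClosed G U ∧
      ∀ Q : GeneralisedPath G, ∃ x ∈ Q.path.verts, x ∈ U := by
  obtain ⟨U₀, Ψ, hU₀, hΨ, hQ₀⟩ := exists_countable_meeting_disjoint h₂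
  choose W hWc hW using fun ω : EndSpace G => exists_countable_meeting_end ω fun S => h₁ S ω
  obtain ⟨U, hWU, hUc, hU⟩ := exists_walkClosed (G := G)
    (hU₀.union (hΨ.biUnion fun ω _ => hWc ω))
  refine ⟨U, hUc, hU, fun Q => ?_⟩
  by_contra! hc
  obtain ⟨ω, hω, hωQ⟩ := hQ₀ Q fun x hx hxU => hc x hx (hWU (Or.inl hxU))
  obtain ⟨x, hx, hxW⟩ := hW ω Q hωQ
  exact hc x hx (hWU (Or.inr (Set.mem_iUnion₂.2 ⟨ω, hω, hxW⟩)))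

/-! ### A countable base -/

theorem exists_exhaustion {U : Set V} (hU : U.Countable) :
    ∃ X : ℕ → Finset V, Monotone X ∧ (∀ n, (X n : Set V) ⊆ U) ∧ ∀ u ∈ U, ∃ n, u ∈ X n := by
  classical
  rcases U.eq_empty_or_nonempty with rfl | hne
  · exact ⟨fun _ => ∅, monotone_const, by simp, by simp⟩
  · obtain ⟨e, rfl⟩ := hU.exists_eq_range hne
    refine ⟨fun n => (Finset.range n).image e, fun m n h =>
      Finset.image_subset_image (Finset.range_mono h), fun n x hx => ?_, ?_⟩
    · obtain ⟨k, -, rfl⟩ := Finset.mem_image.1 hx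
      exact ⟨k, rfl⟩
    · rintro _ ⟨k, rfl⟩
      exact ⟨k + 1, Finset.mem_image.2 ⟨k, by simp, rfl⟩⟩

theorem Finset.exists_inter_subset {U : Set V} {X : ℕ → Finset V} (hX : Monotone X)
    (hXU : ∀ u ∈ U, ∃ n, u ∈ X n) (Y : Finset V) : ∃ N, ∀ n ≥ N, ∀ y ∈ Y, y ∈ U → y ∈ X n := by
  choose! f hf using hXU
  exact ⟨Y.sup f, fun n hn y hy hyU => hX ((Finset.le_sup hy).trans hn) (hf y hyU)⟩

/-- A ray meets `U` infinitely often or has a tail in a component of `G - U`. -/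
theorem Ray.frequently_or_component (R : Ray G) (U : Set V) :
    (∀ N, ∃ n ≥ N, R.toFun n ∈ U) ∨
      ∃ (D : G.ComponentCompl U) (N : ℕ), ∀ n, (R.drop N).toFun n ∈ D := by
  by_cases h : ∀ N, ∃ n ≥ N, R.toFun n ∈ U
  · exact Or.inl h
  · push Not at h
    obtain ⟨N, hN⟩ := h
    obtain ⟨D, hD⟩ := (R.drop N).connSet.exists_component (X := U)
      (by rintro _ ⟨n, rfl⟩; exact hN _ (by simp)) ⟨0, rfl⟩
    exact Or.inr ⟨D, N, fun n => hD _ ⟨n, rfl⟩⟩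

theorem ComponentCompl.subset_comp {U : Set V} {D : G.ComponentCompl U} {X : Finset V}
    (hXU : (X : Set V) ⊆ U) {R : Ray G} (hR : ∀ n, R.toFun n ∈ D) :
    ∀ d ∈ D, d ∈ R.toEnd.comp X := by
  obtain ⟨N, hN⟩ := R.eventually_mem X
  exact (ComponentCompl.connSet D).subset_component
    (fun a ha haX => ComponentCompl.notMem D ha (hXU haX)) _ (hR N) (hN N le_rfl)

theorem ComponentCompl.exists_boundary_mem_comp {U : Set V} {D : G.ComponentCompl U}
    {X : Finset V} (hXU : (X : Set V) ⊆ U) {R : Ray G} (hR : ∀ n, R.toFun n ∈ D) {u : V}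
    (huU : u ∈ U) (hu : u ∈ R.toEnd.comp X) :
    ∃ a ∈ boundary G (D : Set V), a ∈ R.toEnd.comp X := by
  obtain ⟨a, ha, haD⟩ := (ComponentCompl.connSet (R.toEnd.comp X)).inter_boundary
    (ComponentCompl.subset_comp hXU hR _ (hR 0)) (hR 0) hu
    (fun h => ComponentCompl.notMem D h huU)
  exact ⟨a, haD, ha⟩

theorem WalkClosed.connSet_inter {U : Set V} (hU : WalkClosed G U) {X : Finset V}
    (hXU : (X : Set V) ⊆ U) (C : G.ComponentCompl (X : Set V)) : ConnSet G (U ∩ C) := by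
  classical
  rintro a ⟨haU, haC⟩ b ⟨hbU, hbC⟩
  obtain ⟨p, hp⟩ := hU X hXU a haU b hbU (exists_walk_of_mem_component C haC hbC)
  exact ⟨p, fun x hx => ⟨(hp x hx).1, mem_component_of_walk C (p.takeUntil x hx)
    (fun y hy => (hp y (p.support_takeUntil_subset_support hx hy)).2) haC⟩⟩

/-- If every `C(Xₙ, ω)` meets `U`, then the sets `U ∩ C(Xₙ, ω)` converge to an end. -/
theorem exists_end_of_inter_nonempty {U : Set V} (hU : WalkClosed G U)
    {X : ℕ → Finset V} (hX : Monotone X) (hXU : ∀ n, (X n : Set V) ⊆ U)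
    (hXex : ∀ u ∈ U, ∃ n, u ∈ X n) {ω : EndSpace G}
    (hne : ∀ n, (U ∩ ω.comp (X n)).Nonempty) :
    ∃ ω' : EndSpace G, ∀ Y : Finset V, ∃ N, ∀ n ≥ N, ∀ u ∈ U, u ∈ ω.comp (X n) → u ∈ ω'.comp Y := by
  have hanti : Antitone fun n => U ∩ (ω.comp (X n) : Set V) := fun m n h x hx =>
    ⟨hx.1, ω.comp_mono (hX h) x hx.2⟩
  have hconn : ∀ n, ConnSet G (U ∩ ω.comp (X n)) := fun n => hU.connSet_inter (hXU n) _
  obtain ⟨x, hx⟩ := hne 0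
  obtain ⟨R, -, -, hR⟩ := exists_ray_of_antitone _ hanti hconn hne (fun v => by
    by_cases hv : v ∈ U
    · obtain ⟨n, hn⟩ := hXex v hv
      exact ⟨n, fun h => ComponentCompl.notMem _ h.2 hn⟩
    · exact ⟨0, fun h => hv h.1⟩) hx
  refine ⟨R.toEnd, fun Y => ?_⟩
  obtain ⟨N, hN⟩ := Finset.exists_inter_subset hX hXex Y
  refine ⟨N, fun n hn u huU hu => ?_⟩
  obtain ⟨M, hM⟩ := R.eventually_mem Y
  obtain ⟨K, hK⟩ := hR n
  exact (hconn n).subset_component (X := (Y : Set V))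
    (fun a ha haY => ComponentCompl.notMem _ ha.2 (hN n hn a haY ha.1)) _
    (hK (max M K) (le_max_right _ _)) (hM _ (le_max_left _ _)) u ⟨huU, hu⟩

/-- Let `ω'` be the limit of the sets `U ∩ C(X n, ω)`. A ray of `η` meeting `U` infinitely often
belongs to `ω'`. Otherwise it has a tail in a component `D` of `G - U` whose boundary converges to
`ω'`, so `η ≠ ω'` would give a generalised path avoiding `U`. -/
theorem exists_unique_end_of_inter_nonempty {U : Set V} (hU : WalkClosed G U)
    (hmeet : ∀ Q : GeneralisedPath G, ∃ x ∈ Q.path.verts, x ∈ U)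
    {X : ℕ → Finset V} (hX : Monotone X) (hXU : ∀ n, (X n : Set V) ⊆ U)
    (hXex : ∀ u ∈ U, ∃ n, u ∈ X n) {ω : EndSpace G}
    (hne : ∀ n, (U ∩ ω.comp (X n)).Nonempty) :
    (∀ Y : Finset V, ∃ N, ∀ n ≥ N, ∀ u ∈ U, u ∈ ω.comp (X n) → u ∈ ω.comp Y) ∧
      ∀ η : EndSpace G, (∀ n, η.comp (X n) = ω.comp (X n)) → η = ω := by
  obtain ⟨ω', hω'⟩ := exists_end_of_inter_nonempty hU hX hXU hXex hne
  have key : ∀ η : EndSpace G, (∀ n, η.comp (X n) = ω.comp (X n)) → η = ω' := by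
    intro η hη
    obtain ⟨R, rfl⟩ := η.exists_ray
    rcases R.frequently_or_component U with hR | ⟨D, N, hR⟩
    · refine Ray.toEnd_eq_of_frequently fun Y N => ?_
      obtain ⟨n, hn⟩ := hω' Y
      obtain ⟨M, hM⟩ := R.eventually_mem (X n)
      obtain ⟨m, hm, hmU⟩ := hR (max M N)
      exact ⟨m, (le_max_right _ _).trans hm, hn n le_rfl _ hmU
        (hη n ▸ hM m ((le_max_left _ _).trans hm))⟩
    · rw [← R.toEnd_drop N] at hη ⊢
      have hlim : BoundaryLimit (D : Set V) ω' := fun Y => by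
        obtain ⟨n, hn⟩ := hω' Y
        obtain ⟨u, huU, hu⟩ := hne n
        obtain ⟨a, ha, haC⟩ := ComponentCompl.exists_boundary_mem_comp (hXU n) hR huU
          ((hη n).symm ▸ hu)
        exact ⟨a, ha, hn n le_rfl a (ComponentCompl.boundary_subset D ha) (hη n ▸ haC)⟩
      by_contra hne'
      obtain ⟨P, hP⟩ := (ComponentCompl.connSet D).exists_generalisedPath hR (hlim.reaches hU) hne'
      obtain ⟨x, hx, hxU⟩ := hmeet P
      exact ComponentCompl.notMem D (hP hx) hxU
  obtain rfl : ω = ω' := key ω fun _ => rfl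
  exact ⟨hω', key⟩

/-- If some `C(X n, ω)` misses `U`, it contains no end but `ω`, since two ends would be joined by a
generalised path inside it. Otherwise choose `n` so large that `U ∩ C(X n, ω) ⊆ C(Y, ω)` and every
vertex of `Y` still in `C(X n, ω)` stays there forever. Only a ray with a tail in a component `D` of
`G - U` needs care. If `D` meets `Y`, then its end lies in every `C(X m, ω)`, so it is `ω`; if not,
a boundary vertex of `D` in `C(Y, ω)` pulls in all of `D`. -/
theorem exists_endsIn_subset {U : Set V} (hU : WalkClosed G U)
    (hmeet : ∀ Q : GeneralisedPath G, ∃ x ∈ Q.path.verts, x ∈ U)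
    {X : ℕ → Finset V} (hX : Monotone X) (hXU : ∀ n, (X n : Set V) ⊆ U)
    (hXex : ∀ u ∈ U, ∃ n, u ∈ X n) (ω : EndSpace G) (Y : Finset V) :
    ∃ n, endsIn (X n) (ω.comp (X n)) ⊆ endsIn Y (ω.comp Y) := by
  by_cases hne : ∀ n, (U ∩ ω.comp (X n)).Nonempty
  · obtain ⟨h₁, h₂⟩ := exists_unique_end_of_inter_nonempty hU hmeet hX hXU hXex hne
    obtain ⟨N, hN⟩ := h₁ Y
    have hy : ∀ y : V, ∃ n, y ∈ ω.comp (X n) → ∀ m, y ∈ ω.comp (X m) := fun y => by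
      by_cases h : ∀ m, y ∈ ω.comp (X m)
      · exact ⟨0, fun _ => h⟩
      · push Not at h
        obtain ⟨n, hn⟩ := h
        exact ⟨n, fun h => absurd h hn⟩
    choose f hf using hy
    let n := max N (Y.sup f)
    have hfn : ∀ y ∈ Y, y ∈ ω.comp (X n) → ∀ m, y ∈ ω.comp (X m) := fun y hy hyn =>
      hf y (ω.comp_mono (hX ((Finset.le_sup hy).trans (le_max_right _ _))) y hyn)
    refine ⟨n, fun η hη => ?_⟩
    obtain ⟨R, rfl⟩ := η.exists_ray
    change R.toEnd.comp (X n) = ω.comp (X n) at hη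
    change R.toEnd.comp Y = ω.comp Y
    rcases R.frequently_or_component U with hR | ⟨D, M, hR⟩
    · obtain ⟨K, hK⟩ := R.eventually_mem (X n)
      obtain ⟨L, hL⟩ := R.eventually_mem Y
      obtain ⟨m, hm, hmU⟩ := hR (max K L)
      exact ComponentCompl.eq_of_mem (hL m ((le_max_right _ _).trans hm))
        (hN n (le_max_left _ _) _ hmU (hη ▸ hK m ((le_max_left _ _).trans hm)))
    · rw [← R.toEnd_drop M] at hη ⊢
      have hDC : ∀ d ∈ D, d ∈ ω.comp (X n) := hη ▸ ComponentCompl.subset_comp (hXU n) hR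
      by_cases hDY : ∃ y ∈ D, y ∈ Y
      · obtain ⟨y, hyD, hyY⟩ := hDY
        rw [h₂ (R.drop M).toEnd fun m => ComponentCompl.eq_of_mem
          (ComponentCompl.subset_comp (hXU m) hR y hyD) (hfn y hyY (hDC y hyD) m)]
      · push Not at hDY
        obtain ⟨u, huU, hu⟩ := hne n
        obtain ⟨a, ⟨haD, d, hd, hda⟩, haC⟩ := ComponentCompl.exists_boundary_mem_comp (hXU n) hR
          huU (hη.symm ▸ hu)
        have haU : a ∈ U := ComponentCompl.boundary_subset D ⟨haD, d, hd, hda⟩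
        have haω : a ∈ ω.comp Y := hN n (le_max_left _ _) a haU (hη ▸ haC)
        have hdω : d ∈ ω.comp Y :=
          SimpleGraph.ComponentCompl.mem_of_adj _ _ haω (hDY d hd) hda.symm
        obtain ⟨L, hL⟩ := (R.drop M).eventually_mem Y
        exact ComponentCompl.eq_of_mem (hL L le_rfl) ((ComponentCompl.connSet D).subset_component
          (X := (Y : Set V)) hDY _ hd hdω _ (hR L))
  · push Not at hne
    obtain ⟨n, hn⟩ := hne
    refine ⟨n, fun η hη => ?_⟩
    obtain ⟨R, rfl⟩ := η.exists_ray
    obtain ⟨S, rfl⟩ := ω.exists_ray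
    change R.toEnd.comp (X n) = S.toEnd.comp (X n) at hη
    obtain ⟨M, hM⟩ := R.eventually_mem (X n)
    obtain ⟨N, hN⟩ := S.eventually_mem (X n)
    by_cases he : R.toEnd = S.toEnd
    · rw [he]
      rfl
    · obtain ⟨P, hP⟩ := (ComponentCompl.connSet (S.toEnd.comp (X n))).exists_generalisedPath
        (R := R.drop M) (ω := S.toEnd) (fun k => hη ▸ hM _ (by simp))
        (Or.inl ⟨S.drop N, S.toEnd_drop N, fun k => hN _ (by simp)⟩) (by rwa [R.toEnd_drop])
      obtain ⟨x, hx, hxU⟩ := hmeet P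
      exact absurd (show x ∈ U ∩ _ from ⟨hxU, hP hx⟩) (by rw [hn]; exact Set.notMem_empty x)

/-- One end chosen from each component that contains ends gives a simultaneously separated set. -/
theorem countable_range_comp {X : Finset V}
    (h : ∀ Ψ : Set (EndSpace G), SeparatesSimultaneously X Ψ → Ψ.Countable) :
    (Set.range (EndSpace.comp (G := G) X)).Countable := by
  let f : Set.range (EndSpace.comp (G := G) X) → EndSpace G := fun C => C.2.choose
  have hf : ∀ C, (f C).comp X = C.1 := fun C => C.2.choose_spec
  have hc := h (Set.range f) (by
    rintro _ ⟨C, rfl⟩ _ ⟨C', rfl⟩ hne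
    rw [hf, hf]
    exact fun he => hne (congrArg f (Subtype.ext he)))
  refine (hc.image (EndSpace.comp X)).mono ?_
  intro C hC
  exact ⟨f ⟨C, hC⟩, ⟨⟨C, hC⟩, rfl⟩, hf ⟨C, hC⟩⟩

theorem secondCountable_of_countable_families
    (h₁ : ∀ (S : Set (GeneralisedPath G)) (ω : EndSpace G), IsSun S ω → S.Countable)
    (h₂ : ∀ S : Set (GeneralisedPath G), S.Pairwise GeneralisedPath.IsDisjoint → S.Countable)
    (h₃ : ∀ (X : Finset V) (Ψ : Set (EndSpace G)), SeparatesSimultaneously X Ψ → Ψ.Countable) :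
    SecondCountableTopology (EndSpace G) := by
  obtain ⟨U, hUc, hU, hmeet⟩ := exists_countable_meeting h₁ h₂
  obtain ⟨X, hX, hXU, hXex⟩ := exists_exhaustion hUc
  refine ⟨⋃ n, endsIn (X n) '' Set.range (EndSpace.comp (X n)),
    Set.countable_iUnion fun n => (countable_range_comp (h₃ (X n))).image _, le_antisymm ?_ ?_⟩
  · refine le_generateFrom fun s hs => ?_
    obtain ⟨n, C, -, rfl⟩ := Set.mem_iUnion.1 hs
    exact TopologicalSpace.isOpen_generateFrom_of_mem ⟨X n, C, rfl⟩
  · refine le_generateFrom ?_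
    rintro _ ⟨Y, C, rfl⟩
    refine @isOpen_iff_forall_mem_open _ (_) _ |>.2 fun ω hω => ?_
    obtain ⟨n, hn⟩ := exists_endsIn_subset hU hmeet hX hXU hXex ω Y
    refine ⟨endsIn (X n) (ω.comp (X n)), ?_, ?_, rfl⟩
    · rw [← show ω.comp Y = C from hω]
      exact hn
    · exact TopologicalSpace.isOpen_generateFrom_of_mem
        (Set.mem_iUnion.2 ⟨n, _, ⟨ω, rfl⟩, rfl⟩)

/-! ### Consequences of second countability. -/

theorem isOpen_endsIn (X : Finset V) (C : G.ComponentCompl (X : Set V)) : IsOpen (endsIn X C) :=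
  TopologicalSpace.isOpen_generateFrom_of_mem ⟨X, C, rfl⟩

/-- In a second countable end space, countably many finite sets of vertices separate all pairs of
ends. -/
theorem exists_countable_separators [SecondCountableTopology (EndSpace G)] :
    ∃ 𝒳 : Set (Finset V), 𝒳.Countable ∧
      ∀ ω η : EndSpace G, ω ≠ η → ∃ X ∈ 𝒳, ω.comp X ≠ η.comp X := by
  let B := TopologicalSpace.countableBasis (EndSpace G)
  have hB := TopologicalSpace.isBasis_countableBasis (EndSpace G)
  have hBc : Countable B := (TopologicalSpace.countable_countableBasis (EndSpace G)).to_subtype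
  -- One separator per pair of basic sets suffices, because separation by `Y` passes to basic
  -- neighbourhoods inside `endsIn Y _`; `∅` is a dummy for pairs that no finite set separates.
  have hX : ∀ b b' : B, ∃ X : Finset V,
      (∃ Y : Finset V, ∀ ω ∈ b.1, ∀ η ∈ b'.1, ω.comp Y ≠ η.comp Y) →
        ∀ ω ∈ b.1, ∀ η ∈ b'.1, ω.comp X ≠ η.comp X := fun b b' => by
    by_cases h : ∃ Y : Finset V, ∀ ω ∈ b.1, ∀ η ∈ b'.1, ω.comp Y ≠ η.comp Y
    · obtain ⟨Y, hY⟩ := h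
      exact ⟨Y, fun _ => hY⟩
    · exact ⟨∅, fun h' => absurd h' h⟩
  choose X hX using hX
  refine ⟨Set.range fun p : B × B => X p.1 p.2, Set.countable_range _, fun ω η hne => ?_⟩
  obtain ⟨Y, hY⟩ := EndSpace.exists_comp_ne hne
  obtain ⟨b, hb, hωb, hbY⟩ := hB.exists_subset_of_mem_open
    (show ω ∈ endsIn Y (ω.comp Y) from rfl) (isOpen_endsIn _ _)
  obtain ⟨b', hb', hηb, hbY'⟩ := hB.exists_subset_of_mem_open
    (show η ∈ endsIn Y (η.comp Y) from rfl) (isOpen_endsIn _ _)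
  refine ⟨_, ⟨(⟨b, hb⟩, ⟨b', hb'⟩), rfl⟩, hX ⟨b, hb⟩ ⟨b', hb'⟩ ⟨Y, fun ω' hω' η' hη' => ?_⟩
    ω hωb η hηb⟩
  rw [show ω'.comp Y = _ from hbY hω', show η'.comp Y = _ from hbY' hη']
  exact hY

/-- Each path meets the countable union of the separators, and disjointness makes a choice of
meeting vertex injective. This covers both suns and disjoint families. -/
theorem countable_of_vertexDisjoint [SecondCountableTopology (EndSpace G)]
    {S : Set (GeneralisedPath G)} (hS : S.Pairwise GeneralisedPath.VertexDisjoint) :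
    S.Countable := by
  obtain ⟨𝒳, h𝒳, hsep⟩ := exists_countable_separators (G := G)
  have hmeet : ∀ P : GeneralisedPath G, ∃ x ∈ P.path.verts, x ∈ ⋃ X ∈ 𝒳, (X : Set V) := fun P => by
    obtain ⟨ω, η, hne, he⟩ := P.exists_pair
    obtain ⟨X, hX, hXne⟩ := hsep ω η hne
    obtain ⟨x, hx, hxX⟩ := P.meets_separator (by rw [he]; exact Set.mem_insert _ _)
      (by rw [he]; exact Set.mem_insert_of_mem _ rfl) hXne
    exact ⟨x, hx, Set.mem_iUnion₂.2 ⟨X, hX, hxX⟩⟩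
  choose f hfP hfX using hmeet
  refine Set.MapsTo.countable_of_injOn (f := f) (fun P _ => hfX P) (fun P hP Q hQ he => ?_)
    (h𝒳.biUnion fun X _ => X.countable_toSet)
  by_contra hne
  exact Set.disjoint_left.1 (hS hP hQ hne) (hfP P) (he ▸ hfP Q)

theorem SeparatesSimultaneously.countable [SecondCountableTopology (EndSpace G)] {X : Finset V}
    {Ψ : Set (EndSpace G)} (h : SeparatesSimultaneously X Ψ) : Ψ.Countable := by
  refine Set.PairwiseDisjoint.countable_of_isOpen (s := fun ω : EndSpace G => endsIn X (ω.comp X))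
    (fun ω hω η hη hne => Set.disjoint_left.2 fun ζ hζ hζ' => h hω hη hne ?_)
    (fun ω _ => isOpen_endsIn _ _) (fun ω _ => ⟨ω, rfl⟩)
  exact (show ζ.comp X = _ from hζ).symm.trans hζ'

end GraphEnds

theorem mainTheorem7 {V : Type*} (G : SimpleGraph V) (hG : G.Connected) :
    ¬ SecondCountableTopology (GraphEnds.EndSpace G) ↔
      (∃ (S : Set (GraphEnds.GeneralisedPath G)) (ω : GraphEnds.EndSpace G),
          ¬ S.Countable ∧ GraphEnds.IsSun S ω) ∨
      (∃ S : Set (GraphEnds.GeneralisedPath G),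
          ¬ S.Countable ∧ S.Pairwise GraphEnds.GeneralisedPath.IsDisjoint) ∨
      (∃ (X : Finset V) (Ψ : Set (GraphEnds.EndSpace G)),
          ¬ Ψ.Countable ∧ GraphEnds.SeparatesSimultaneously X Ψ) := by
  constructor
  · intro h
    by_contra hno
    rw [not_or, not_or] at hno
    obtain ⟨h₁, h₂, h₃⟩ := hno
    refine h (GraphEnds.secondCountable_of_countable_families (fun S ω hS => ?_) (fun S hS => ?_)
      (fun X Ψ hΨ => ?_))
    · by_contra hc
      exact h₁ ⟨S, ω, hc, hS⟩
    · by_contra hc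
      exact h₂ ⟨S, hc, hS⟩
    · by_contra hc
      exact h₃ ⟨X, Ψ, hc, hΨ⟩
  · rintro (⟨S, ω, hc, leaf, hstar, -⟩ | ⟨S, hc, hS⟩ | ⟨X, Ψ, hc, hΨ⟩) h
    · exact hc (GraphEnds.countable_of_vertexDisjoint hstar.vertexDisjoint)
    · exact hc (GraphEnds.countable_of_vertexDisjoint fun P hP Q hQ hne => (hS hP hQ hne).1)
    · exact hc hΨ.countable
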